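/- **Setting.** Let $d,s\ge 2$. For $W\in\mathbb R^{a\times b}$ and $x\in\mathbb R^b$ put $W_{+,x}=\mathrm{diag}(Wx>0)\,W$ (the rows of $W$ having non-positive inner product with $x$ are replaced by $0$). Let $W^{(1)}_i\in\mathbb R^{n_i\times n_{i-1}}$ ($1\le i\le d$, $n_0=n$, $n_d=\ell$) and $W^{(2)}_i\in\mathbb R^{p_i\times p_{i-1}}$ ($1\le i\le s$, $p_0=p$, $p_s=\ell$) be the weights of the ReLU networks $\mathcal G^{(1)}(h)=\mathrm{relu}(W^{(1)}_d\cdots\mathrm{relu}(W^{(1)}_1h)\cdots)$ and $\mathcal G^{(2)}(m)=\mathrm{relu}(W^{(2)}_s\cdots\mathrm{relu}(W^{(2)}_1m)\cdots)$. For $h\in\mathbb R^n$ let $W^{(1)}_{i,+,h}=\mathrm{diag}(W^{(1)}_iW^{(1)}_{i-1,+,h}\cdots W^{(1)}_{1,+,h}h>0)\,W^{(1)}_i$ and $\Lambda_h=W^{(1)}_{d,+,h}\cdots W^{(1)}_{1,+,h}$; for $m\in\mathbb R^p$ define $\Lambda_m$ in the same way from $W^{(2)}_1,\dots,W^{(2)}_s$.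 For nonzero $x,y\in\mathbb R^k$ with angle $\theta=\angle(x,y)$ let $Q_{x,y}=\frac{\pi-\theta}{2\pi}I+\frac{\sin\theta}{2\pi}M_{\hat x\leftrightarrow\hat y}$, where $M_{\hat x\leftrightarrow\hat y}$ exchanges $\hat x=x/\|x\|$ and $\hat y=y/\|y\|$ and vanishes on $\mathrm{span}\{x,y\}^\perp$. All matrix norms are spectral norms and all vector norms are Euclidean. * $W$ with rows $w_1,\dots,w_a\in\mathbb R^k$ satisfies the **WDC** with constants $\epsilon>0$, $0<\alpha\le1$ if $\big\|\sum_{i}\mathbf 1_{w_i\cdot x>0}\mathbf 1_{w_i\cdot y>0}\,w_iw_i^\top-\alpha Q_{x,y}\big\|\le\epsilon$ for all nonzero $x,y\in\mathbb R^k$. * $B\in\mathbb R^{\ell\times a}$ and $C\in\mathbb R^{\ell\times b}$ satisfy the **joint-WDC** with constants $\epsilon,\alpha$ if for all nonzero $h,x\in\mathbb R^a$ and nonzero $m,y\in\mathbb R^b$ $$\Big\|B_{+,h}^\top\mathrm{diag}(C_{+,m}m\odot C_{+,y}y)B_{+,x}-\tfrac{\alpha}{\ell}(m^\top Q_{m,y}y)\,Q_{h,x}\Big\|\le\tfrac{\epsilon}{\ell}\|m\|\|y\|,$$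 $$\Big\|C_{+,m}^\top\mathrm{diag}(B_{+,h}h\odot B_{+,x}x)C_{+,y}-\tfrac{\alpha}{\ell}(h^\top Q_{h,x}x)\,Q_{m,y}\Big\|\le\tfrac{\epsilon}{\ell}\|h\|\|x\|.$$ Let $g(\theta)=\cos^{-1}\!\big(\frac{(\pi-\theta)\cos\theta+\sin\theta}{\pi}\big)$. For nonzero $u,v$ put $\bar\theta_0=\angle(u,v)$, $\bar\theta_i=g(\bar\theta_{i-1})$ and $$\tilde t^{[a]}_{u,v}=\frac1{2^a}\Big[\Big(\prod_{i=0}^{a-1}\frac{\pi-\bar\theta_i}{\pi}\Big)v+\sum_{i=0}^{a-1}\frac{\sin\bar\theta_i}{\pi}\Big(\prod_{j=i+1}^{a-1}\frac{\pi-\bar\theta_j}{\pi}\Big)\frac{\|v\|}{\|u\|}u\Big],\qquad \tilde t^{(1)}=\tilde t^{[d]},\quad \tilde t^{(2)}=\tilde t^{[s]}.$$ **Hypotheses.** Let $0<\epsilon<1/((d^4+s^4)16\pi)^2$, $0<\alpha_1,\alpha_2\le1$ and $\alpha=\alpha_1\alpha_2$. Suppose that $W^{(1)}_1,\dots,W^{(1)}_{d-1}$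 and $W^{(2)}_1,\dots,W^{(2)}_{s-1}$ satisfy the WDC with constants $\epsilon$ and $1$, that $W^{(1)}_d$ satisfies the WDC with constants $\epsilon,\alpha_1$, that $W^{(2)}_s$ satisfies the WDC with constants $\epsilon,\alpha_2$, and that $(W^{(1)}_d,W^{(2)}_s)$ satisfies the joint-WDC with constants $\epsilon,\alpha$. **Conclusion 1.** For all nonzero $h,x\in\mathbb R^n$ and nonzero $m,y\in\mathbb R^p$, $$\Big\|\Lambda_h^\top\mathrm{diag}(\Lambda_mm\odot\Lambda_yy)\Lambda_xx-\tfrac{\alpha}{\ell}\big(m^\top\tilde t^{(2)}_{m,y}\big)\tilde t^{(1)}_{h,x}\Big\|\le\frac{208\,d^3s^3\sqrt\epsilon}{2^{d+s}\ell}\|x\|\|m\|\|y\|,$$ $$\Big\|\Lambda_m^\top\mathrm{diag}(\Lambda_hh\odot\Lambda_xx)\Lambda_yy-\tfrac{\alpha}{\ell}\big(h^\top\tilde t^{(1)}_{h,x}\big)\tilde t^{(2)}_{m,y}\Big\|\le\frac{208\,d^3s^3\sqrt\epsilon}{2^{d+s}\ell}\|y\|\|h\|\|x\|.$$ **Conclusion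 2.** Let $h_0\in\mathbb R^n$ and $m_0\in\mathbb R^p$ be nonzero, let $f(h,m)=\frac12\|\mathcal G^{(1)}(h_0)\odot\mathcal G^{(2)}(m_0)-\mathcal G^{(1)}(h)\odot\mathcal G^{(2)}(m)\|^2$, and $$t^{(1)}_{(h,m)}=\tfrac{\alpha}{2^{d+s}\ell}\|m\|^2h-\tfrac{\alpha}{\ell}\big(m^\top\tilde t^{(2)}_{m,m_0}\big)\tilde t^{(1)}_{h,h_0},\qquad t^{(2)}_{(h,m)}=\tfrac{\alpha}{2^{d+s}\ell}\|h\|^2m-\tfrac{\alpha}{\ell}\big(h^\top\tilde t^{(1)}_{h,h_0}\big)\tilde t^{(2)}_{m,m_0}.$$ Then $t^{(1)}$ and $t^{(2)}$ are continuous in $(h,m)$ on $\{h\ne0,\ m\ne0\}$, and for all nonzero $h\in\mathbb R^n$, $m\in\mathbb R^p$ $$\|v^{(1)}-t^{(1)}_{(h,m)}\|\le\frac{416\,d^3s^3\sqrt\epsilon}{2^{d+s}\ell}\max(\|h\|\|m\|,\|h_0\|\|m_0\|)\,\|m\|,\qquad \|v^{(2)}-t^{(2)}_{(h,m)}\|\le\frac{416\,d^3s^3\sqrt\epsilon}{2^{d+s}\ell}\max(\|h\|\|m\|,\|h_0\|\|m_0\|)\,\|h\|$$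 in each of the following cases: * $v^{(1)},v^{(2)}$ are the explicit expressions $v^{(1)}=\Lambda_h^\top\big(\mathrm{diag}(\Lambda_mm)^2\Lambda_hh-\mathrm{diag}(\Lambda_mm\odot\Lambda_{m_0}m_0)\Lambda_{h_0}h_0\big)$ and $v^{(2)}=\Lambda_m^\top\big(\mathrm{diag}(\Lambda_hh)^2\Lambda_mm-\mathrm{diag}(\Lambda_hh\odot\Lambda_{h_0}h_0)\Lambda_{m_0}m_0\big)$; * $v^{(1)}=\nabla_hf(h,m)$ (respectively $v^{(2)}=\nabla_mf(h,m)$), whenever $f$ is differentiable in $h$ (respectively in $m$) at $(h,m)$; * $v^{(1)}=\lim_{\delta\to0^+}\nabla_hf((h,m)+\delta w)$ (respectively $v^{(2)}=\lim_{\delta\to0^+}\nabla_mf((h,m)+\delta w)$), for any direction $w\in\mathbb R^n\times\mathbb R^p$ such that these partial gradients exist for all sufficiently small $\delta>0$ and the limit exists. -/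

import Mathlib

open scoped Matrix Topology

noncomputable section

namespace BlindDemod

/-- Matrix acting on Euclidean space. -/
def act {a b : ℕ} (A : Matrix (Fin a) (Fin b) ℝ) (x : EuclideanSpace ℝ (Fin b)) :
    EuclideanSpace ℝ (Fin a) :=
  WithLp.toLp 2 (A *ᵥ x.ofLp)

/-- Spectral norm (`ℓ²` operator norm) of a square real matrix. -/
def specNorm {k : ℕ} (A : Matrix (Fin k) (Fin k) ℝ) : ℝ :=
  ‖Matrix.toEuclideanCLM (n := Fin k) (𝕜 := ℝ) A‖

/-- Entrywise product of two vectors. -/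
def hadamard {a : ℕ} (u v : EuclideanSpace ℝ (Fin a)) : EuclideanSpace ℝ (Fin a) :=
  WithLp.toLp 2 (fun i => u i * v i)

/-- `W_{+,x} = diag(W x > 0) W`: the rows of `W` whose inner product with `x` is not positive are
replaced by zero. -/
def plusPart {a b : ℕ} (W : Matrix (Fin a) (Fin b) ℝ) (x : EuclideanSpace ℝ (Fin b)) :
    Matrix (Fin a) (Fin b) ℝ :=
  Matrix.diagonal (fun i => if 0 < act W x i then (1 : ℝ) else 0) * W

/-! ### The matrices `M` and `Q` -/

/-- The unit vector `x / ‖x‖`. -/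
def unitVec {k : ℕ} (x : EuclideanSpace ℝ (Fin k)) : EuclideanSpace ℝ (Fin k) := ‖x‖⁻¹ • x

/-- The matrix `M` that exchanges the unit vectors `x̂ = x/‖x‖` and `ŷ = y/‖y‖` and vanishes on the
orthogonal complement of `span {x, y}`: project orthogonally onto `span {x, y}`, then reflect in
the line through `x̂ + ŷ` (which is `z ↦ -z` when `x̂ + ŷ = 0`). The three defining properties are
proved below. -/
def swapMatrix {k : ℕ} (x y : EuclideanSpace ℝ (Fin k)) : Matrix (Fin k) (Fin k) ℝ :=
  (Matrix.toEuclideanCLM (n := Fin k) (𝕜 := ℝ)).symm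
    (((Submodule.span ℝ {unitVec x + unitVec y}).reflection :
        EuclideanSpace ℝ (Fin k) →L[ℝ] EuclideanSpace ℝ (Fin k)) ∘L
      (Submodule.span ℝ {x, y}).starProjection)

theorem act_swapMatrix {k : ℕ} (x y z : EuclideanSpace ℝ (Fin k)) :
    act (swapMatrix x y) z =
      (Submodule.span ℝ {unitVec x + unitVec y}).reflection
        ((Submodule.span ℝ {x, y}).starProjection z) := by
  have h : act (swapMatrix x y) z =
      Matrix.toEuclideanCLM (n := Fin k) (𝕜 := ℝ) (swapMatrix x y) z := rfl
  rw [h, swapMatrix, StarAlgEquiv.apply_symm_apply]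
  rfl

theorem unitVec_mem_left {k : ℕ} (x y : EuclideanSpace ℝ (Fin k)) :
    unitVec x ∈ Submodule.span ℝ {x, y} :=
  Submodule.smul_mem _ _ (Submodule.subset_span (by simp))

theorem unitVec_mem_right {k : ℕ} (x y : EuclideanSpace ℝ (Fin k)) :
    unitVec y ∈ Submodule.span ℝ {x, y} :=
  Submodule.smul_mem _ _ (Submodule.subset_span (by simp))

theorem norm_unitVec {k : ℕ} {x : EuclideanSpace ℝ (Fin k)} (hx : x ≠ 0) : ‖unitVec x‖ = 1 := by
  rw [unitVec, norm_smul, norm_inv, norm_norm, inv_mul_cancel₀ (norm_ne_zero_iff.mpr hx)]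

theorem reflection_swap {k : ℕ} {u v : EuclideanSpace ℝ (Fin k)} (h : ‖u‖ = ‖v‖) :
    (Submodule.span ℝ {u + v}).reflection u = v := by
  have h1 : (Submodule.span ℝ {u + v}).reflection (u + v) = u + v :=
    Submodule.reflection_mem_subspace_eq_self (Submodule.mem_span_singleton_self _)
  have h2 : (Submodule.span ℝ {u + v}).reflection (u - v) = -(u - v) := by
    apply Submodule.reflection_mem_subspace_orthogonalComplement_eq_neg
    rw [Submodule.mem_orthogonal_singleton_iff_inner_right]
    exact (real_inner_add_sub_eq_zero_iff u v).mpr h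
  have h3 : (2 : ℝ) • u = (u + v) + (u - v) := by
    rw [two_smul]; abel
  have h4 : (2 : ℝ) • (Submodule.span ℝ {u + v}).reflection u = (2 : ℝ) • v := by
    rw [← map_smul, h3, map_add, h1, h2, two_smul]; abel
  exact smul_right_injective _ (two_ne_zero : (2 : ℝ) ≠ 0) h4

/-- `M x̂ = ŷ`. -/
theorem act_swapMatrix_left {k : ℕ} {x y : EuclideanSpace ℝ (Fin k)} (hx : x ≠ 0) (hy : y ≠ 0) :
    act (swapMatrix x y) (unitVec x) = unitVec y := by
  rw [act_swapMatrix, Submodule.starProjection_eq_self_iff.mpr (unitVec_mem_left x y)]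
  exact reflection_swap (by rw [norm_unitVec hx, norm_unitVec hy])

/-- `M ŷ = x̂`. -/
theorem act_swapMatrix_right {k : ℕ} {x y : EuclideanSpace ℝ (Fin k)} (hx : x ≠ 0) (hy : y ≠ 0) :
    act (swapMatrix x y) (unitVec y) = unitVec x := by
  rw [act_swapMatrix, Submodule.starProjection_eq_self_iff.mpr (unitVec_mem_right x y),
    add_comm (unitVec x)]
  exact reflection_swap (by rw [norm_unitVec hx, norm_unitVec hy])

/-- `M z = 0` for `z` orthogonal to `x` and `y`. -/
theorem act_swapMatrix_orthogonal {k : ℕ} {x y z : EuclideanSpace ℝ (Fin k)}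
    (hz : z ∈ (Submodule.span ℝ {x, y})ᗮ) : act (swapMatrix x y) z = 0 := by
  rw [act_swapMatrix, (Submodule.starProjection_apply_eq_zero_iff _).mpr hz, map_zero]

/-- `Q_{x,y} = (π - θ)/(2π) I + sin θ/(2π) M`, with `θ = ∠(x, y)`. -/
def Q {k : ℕ} (x y : EuclideanSpace ℝ (Fin k)) : Matrix (Fin k) (Fin k) ℝ :=
  ((Real.pi - InnerProductGeometry.angle x y) / (2 * Real.pi)) • (1 : Matrix (Fin k) (Fin k) ℝ) +
    (Real.sin (InnerProductGeometry.angle x y) / (2 * Real.pi)) • swapMatrix x y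

/-! ### The two deterministic conditions -/

/-- Weight Distributed Condition for `W` (with rows `w_i`) with constants `ε` and `α`:
`‖∑ i, 1_{w_i · x > 0} 1_{w_i · y > 0} w_i w_iᵀ - α Q_{x,y}‖ ≤ ε` for all nonzero `x`, `y`. -/
def WDC {a k : ℕ} (W : Matrix (Fin a) (Fin k) ℝ) (ε α : ℝ) : Prop :=
  ∀ x y : EuclideanSpace ℝ (Fin k), x ≠ 0 → y ≠ 0 →
    specNorm ((∑ i : Fin a, if 0 < W i ⬝ᵥ x.ofLp ∧ 0 < W i ⬝ᵥ y.ofLp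
        then Matrix.vecMulVec (W i) (W i) else 0) - α • Q x y) ≤ ε

/-- One of the two inequalities of the joint Weight Distributed Condition, the other being the
same with the two matrices exchanged. -/
def HalfJointWDC {ℓ a b : ℕ} (B : Matrix (Fin ℓ) (Fin a) ℝ) (C : Matrix (Fin ℓ) (Fin b) ℝ)
    (ε α : ℝ) : Prop :=
  ∀ (h x : EuclideanSpace ℝ (Fin a)) (m y : EuclideanSpace ℝ (Fin b)),
    h ≠ 0 → x ≠ 0 → m ≠ 0 → y ≠ 0 →
    specNorm ((plusPart B h)ᵀ *
          Matrix.diagonal (hadamard (act (plusPart C m) m) (act (plusPart C y) y)).ofLp *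
          plusPart B x
        - (α / ℓ * inner ℝ m (act (Q m y) y)) • Q h x) ≤ ε / ℓ * ‖m‖ * ‖y‖

/-- Joint Weight Distributed Condition for `B`, `C` with constants `ε` and `α`. -/
def JointWDC {ℓ a b : ℕ} (B : Matrix (Fin ℓ) (Fin a) ℝ) (C : Matrix (Fin ℓ) (Fin b) ℝ)
    (ε α : ℝ) : Prop :=
  HalfJointWDC B C ε α ∧ HalfJointWDC C B ε α

/-! ### ReLU networks without bias terms -/

/-- The weights of a network with `d` layers and output dimension `ℓ`. The matrix of layer `i + 1`
is `hidden i` for `i + 1 < d`, and `outer` is that of layer `d`; the values of `dim` and `hidden`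
at larger indices play no role. -/
structure Net (d ℓ : ℕ) where
  /-- `dim i` is the number of neurons `n_i`; the latent dimension is `dim 0`. -/
  dim : ℕ → ℕ
  /-- `hidden i` is the `(i+1)`-st weight matrix. -/
  hidden : ∀ i : ℕ, Matrix (Fin (dim (i + 1))) (Fin (dim i)) ℝ
  /-- The last weight matrix. -/
  outer : Matrix (Fin ℓ) (Fin (dim (d - 1))) ℝ

namespace Net

variable {d ℓ : ℕ} (N : Net d ℓ)

/-- The latent space of the network. -/
abbrev Latent : Type := EuclideanSpace ℝ (Fin (N.dim 0))

/-- Entrywise positive part. -/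
def relu {a : ℕ} (u : EuclideanSpace ℝ (Fin a)) : EuclideanSpace ℝ (Fin a) :=
  WithLp.toLp 2 (fun i => max (u i) 0)

/-- Output of the first `k` hidden layers. -/
def hiddenOut : (k : ℕ) → N.Latent → EuclideanSpace ℝ (Fin (N.dim k))
  | 0, x => x
  | k + 1, x => relu (act (N.hidden k) (hiddenOut k x))

/-- The generative model `𝒢(x) = relu(W_d ⋯ relu(W_1 x) ⋯)`. -/
def gen (x : N.Latent) : EuclideanSpace ℝ (Fin ℓ) :=
  relu (act N.outer (N.hiddenOut (d - 1) x))

/-- `W_{k,+,x} ⋯ W_{2,+,x} W_{1,+,x}` for the hidden layers, where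
`W_{i,+,x} = diag(W_i W_{i-1,+,x} ⋯ W_{1,+,x} x > 0) W_i`. -/
def hiddenLam : (k : ℕ) → N.Latent → Matrix (Fin (N.dim k)) (Fin (N.dim 0)) ℝ
  | 0, _ => 1
  | k + 1, x => plusPart (N.hidden k) (act (hiddenLam k x) x) * hiddenLam k x

/-- `Λ_{d,+,x} = W_{d,+,x} ⋯ W_{1,+,x}`. -/
def lam (x : N.Latent) : Matrix (Fin ℓ) (Fin (N.dim 0)) ℝ :=
  plusPart N.outer (act (N.hiddenLam (d - 1) x) x) * N.hiddenLam (d - 1) x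

/-- All hidden layers satisfy the WDC with constants `ε` and `1`, and the last layer satisfies it
with constants `ε` and `α`. -/
def LayersWDC (ε α : ℝ) : Prop :=
  (∀ i : ℕ, i < d - 1 → WDC (N.hidden i) ε 1) ∧ WDC N.outer ε α

end Net

/-! ### The cross terms, the objective and its gradients -/

section TwoNets

variable {d s ℓ : ℕ} (N₁ : Net d ℓ) (N₂ : Net s ℓ)

/-- `Λ_hᵀ diag(Λ_m m ⊙ Λ_y y) Λ_x x`, with `Λ_h`, `Λ_x` from `N₁` and `Λ_m`, `Λ_y` from `N₂`. -/
def crossTerm (h x : N₁.Latent) (m y : N₂.Latent) : N₁.Latent :=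
  act ((N₁.lam h)ᵀ * Matrix.diagonal (hadamard (act (N₂.lam m) m) (act (N₂.lam y) y)).ofLp *
    N₁.lam x) x

/-- The objective `f(h, m) = ½ ‖𝒢₁(h₀) ⊙ 𝒢₂(m₀) - 𝒢₁(h) ⊙ 𝒢₂(m)‖²`. -/
def objective (h₀ : N₁.Latent) (m₀ : N₂.Latent) (h : N₁.Latent) (m : N₂.Latent) : ℝ :=
  1 / 2 * ‖hadamard (N₁.gen h₀) (N₂.gen m₀) - hadamard (N₁.gen h) (N₂.gen m)‖ ^ 2

/-- `Λ_hᵀ (diag(Λ_m m)² Λ_h h - diag(Λ_m m ⊙ Λ_{m₀} m₀) Λ_{h₀} h₀)`, the explicit expression for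
the partial gradient of the objective in the variable of the first network. -/
def gradExpr (h₀ : N₁.Latent) (m₀ : N₂.Latent) (h : N₁.Latent) (m : N₂.Latent) : N₁.Latent :=
  act (N₁.lam h)ᵀ
    (act (Matrix.diagonal (act (N₂.lam m) m).ofLp ^ 2) (act (N₁.lam h) h) -
      act (Matrix.diagonal (hadamard (act (N₂.lam m) m) (act (N₂.lam m₀) m₀)).ofLp)
        (act (N₁.lam h₀) h₀))

end TwoNets

/-! ### The limiting vectors -/

/-- `g(θ) = arccos(((π - θ) cos θ + sin θ) / π)`. -/
def g (θ : ℝ) : ℝ :=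
  Real.arccos (((Real.pi - θ) * Real.cos θ + Real.sin θ) / Real.pi)

/-- The angles `θ̄_0 = ∠(p, q)`, `θ̄_i = g(θ̄_{i-1})`. -/
def thetaBar {k : ℕ} (p q : EuclideanSpace ℝ (Fin k)) (i : ℕ) : ℝ :=
  g^[i] (InnerProductGeometry.angle p q)

/-- The vector `t̃_{p,q}` for a network with `a` layers. -/
def tTilde {k : ℕ} (a : ℕ) (p q : EuclideanSpace ℝ (Fin k)) : EuclideanSpace ℝ (Fin k) :=
  (1 / 2 ^ a : ℝ) •
    ((∏ i ∈ Finset.range a, (Real.pi - thetaBar p q i) / Real.pi) • q +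
      ∑ i ∈ Finset.range a,
        (Real.sin (thetaBar p q i) / Real.pi *
          (∏ j ∈ Finset.Ico (i + 1) a, (Real.pi - thetaBar p q j) / Real.pi) *
          (‖q‖ / ‖p‖)) • p)

/-- `α/(2^{a+b} ℓ) ‖v‖² u - (α/ℓ) (vᵀ t̃_{v,v₀}) t̃_{u,u₀}`, where `u` is the latent vector of a
network with `a` layers and `v` that of a network with `b` layers. This is `t⁽¹⁾` for
`(a, b, u, v) = (d, s, h, m)` and `t⁽²⁾` for `(a, b, u, v) = (s, d, m, h)`. -/
def tVec {j k : ℕ} (a b ℓ : ℕ) (α : ℝ) (u₀ : EuclideanSpace ℝ (Fin j))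
    (v₀ : EuclideanSpace ℝ (Fin k)) (u : EuclideanSpace ℝ (Fin j))
    (v : EuclideanSpace ℝ (Fin k)) : EuclideanSpace ℝ (Fin j) :=
  (α / (2 ^ (a + b) * ℓ) * ‖v‖ ^ 2) • u -
    (α / ℓ * inner ℝ v (tTilde b v v₀)) • tTilde a u u₀

end BlindDemod

end

/-! The proof compares the networks layer by layer with their idealized behaviour. By the WDC,
`W_{+,x}ᵀ W_{+,y}` is close to `Q_{x,y}` for a hidden layer. For x = y this matrix is I/2, so a
layer scales every norm by a factor between √(1/2 - ε) and √(1/2 + ε). In general xᵀ Q_{x,y} y =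
½‖x‖‖y‖ cos (g θ), so a layer moves angles as `g` does, up to 5√ε; since `g` is nonexpansive on [0,
π], these errors merely add up (`abs_angle_fwd_sub_thetaBar_le`).

The vector Q_{x,y} y is a combination of x and y. Replacing the top layer by Q in Λ_hᵀ Λ_x x
therefore leaves the same product one layer lower plus a multiple of Λ_hᵀ Λ_h h, which is nearly 2⁻ᵏ
h after k layers. This is the recursion that `tTilde` satisfies exactly; errors of order k√ε per
layer sum to 2k²√ε (`norm_transpose_fwd_sub_tTilde_le`).

In a cross term the joint-WDC replaces the two last layers by (α/ℓ)(mᵀ Q m')Q at the hidden outputs.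
Each Q then plays the part of one more layer of its own network
(`norm_transpose_act_Q_sub_tTilde_le`), and `norm_crossTerm_sub_le` multiplies the two
approximations.

The explicit gradient is a difference of two cross terms, whence 416 = 2 · 208. For true gradients,
activation patterns freeze along a ray for small δ > 0, so a directional derivative pairs the
direction with a one-sided limit of explicit expressions. The bound survives the limit because t is
continuous, and testing in the single direction v - t bounds the gradient v itself. -/

namespace BlindDemod

/-! ### Linear algebra of `act` -/

section ActBasics

variable {a b c k : ℕ}

theorem act_add (A : Matrix (Fin a) (Fin b) ℝ) (x y : EuclideanSpace ℝ (Fin b)) :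
    act A (x + y) = act A x + act A y := by
  simp [act, Matrix.mulVec_add]

theorem act_sub (A : Matrix (Fin a) (Fin b) ℝ) (x y : EuclideanSpace ℝ (Fin b)) :
    act A (x - y) = act A x - act A y := by
  simp [act, Matrix.mulVec_sub]

theorem act_smul (A : Matrix (Fin a) (Fin b) ℝ) (t : ℝ) (x : EuclideanSpace ℝ (Fin b)) :
    act A (t • x) = t • act A x := by
  simp [act, Matrix.mulVec_smul]

theorem add_act (A B : Matrix (Fin a) (Fin b) ℝ) (x : EuclideanSpace ℝ (Fin b)) :
    act (A + B) x = act A x + act B x := by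
  simp [act, Matrix.add_mulVec]

theorem sub_act (A B : Matrix (Fin a) (Fin b) ℝ) (x : EuclideanSpace ℝ (Fin b)) :
    act (A - B) x = act A x - act B x := by
  simp [act, Matrix.sub_mulVec]

theorem smul_act (t : ℝ) (A : Matrix (Fin a) (Fin b) ℝ) (x : EuclideanSpace ℝ (Fin b)) :
    act (t • A) x = t • act A x := by
  simp [act, Matrix.smul_mulVec]

theorem one_act (x : EuclideanSpace ℝ (Fin b)) : act (1 : Matrix (Fin b) (Fin b) ℝ) x = x := by
  simp [act]

theorem mul_act (A : Matrix (Fin a) (Fin b) ℝ) (B : Matrix (Fin b) (Fin c) ℝ)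
    (x : EuclideanSpace ℝ (Fin c)) : act (A * B) x = act A (act B x) := by
  simp [act, Matrix.mulVec_mulVec]

theorem act_diagonal (u : Fin a → ℝ) (x : EuclideanSpace ℝ (Fin a)) (i : Fin a) :
    act (Matrix.diagonal u) x i = u i * x i := by
  simp [act, Matrix.mulVec_diagonal]

theorem inner_act_transpose (A : Matrix (Fin a) (Fin b) ℝ) (x : EuclideanSpace ℝ (Fin b))
    (y : EuclideanSpace ℝ (Fin a)) : inner ℝ x (act Aᵀ y) = inner ℝ (act A x) y := by
  simp only [EuclideanSpace.inner_eq_star_dotProduct, act, star_trivial]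
  rw [Matrix.mulVec_transpose, ← Matrix.dotProduct_mulVec]

theorem continuous_act (A : Matrix (Fin a) (Fin b) ℝ) : Continuous (act A) := by
  unfold act
  fun_prop

theorem norm_act_le_specNorm (A : Matrix (Fin k) (Fin k) ℝ) (x : EuclideanSpace ℝ (Fin k)) :
    ‖act A x‖ ≤ specNorm A * ‖x‖ :=
  (Matrix.toEuclideanCLM (n := Fin k) (𝕜 := ℝ) A).le_opNorm x

/-- A bound for the action of a matrix is also one for the action of its transpose. -/
theorem norm_act_transpose_le {A : Matrix (Fin a) (Fin b) ℝ} {t : ℝ} (ht : 0 ≤ t)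
    (hA : ∀ x, ‖act A x‖ ≤ t * ‖x‖) (y : EuclideanSpace ℝ (Fin a)) :
    ‖act Aᵀ y‖ ≤ t * ‖y‖ := by
  rcases (norm_nonneg (act Aᵀ y)).eq_or_lt with h0 | h0
  · rw [← h0]
    positivity
  · have h1 : ‖act Aᵀ y‖ ^ 2 ≤ t * ‖act Aᵀ y‖ * ‖y‖ := by
      rw [← real_inner_self_eq_norm_sq, inner_act_transpose]
      exact (real_inner_le_norm _ _).trans
        (mul_le_mul_of_nonneg_right (hA _) (norm_nonneg _))
    nlinarith

end ActBasics

/-! ### The function `g` -/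

section AngleMap

open Real

/-- The cosine of `g θ`. -/
noncomputable def cosG (θ : ℝ) : ℝ := ((π - θ) * cos θ + sin θ) / π

theorem hasDerivAt_cosG (θ : ℝ) : HasDerivAt cosG (-((π - θ) * sin θ) / π) θ := by
  have h1 : HasDerivAt (fun t : ℝ => π - t) (-1) θ := by
    simpa using (hasDerivAt_id θ).const_sub π
  have h := ((h1.mul (hasDerivAt_cos θ)).add (hasDerivAt_sin θ)).div_const π
  exact h.congr_deriv (by ring)

/-- The expression vanishes at u = π and has derivative -4u sin² u. With u = π - θ it is π² (1 -
cosG² - cosG'²) at θ, the gap that makes |g'| ≤ 1. -/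
theorem sq_gap_pos {u : ℝ} (h0 : 0 ≤ u) (hu : u < π) :
    0 < π ^ 2 - u ^ 2 + 2 * u * cos u * sin u - sin u ^ 2 := by
  have hd : ∀ x : ℝ, HasDerivAt
      (fun u : ℝ => π ^ 2 - u ^ 2 + 2 * u * cos u * sin u - sin u ^ 2)
      (-(4 * x * sin x ^ 2)) x := by
    intro x
    have h := ((((hasDerivAt_id x).pow 2).const_sub (π ^ 2)).add
      ((((hasDerivAt_id x).const_mul 2).mul (hasDerivAt_cos x)).mul (hasDerivAt_sin x))).sub
      ((hasDerivAt_sin x).pow 2)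
    refine h.congr_deriv ?_
    have := sin_sq_add_cos_sq x
    simp
    linear_combination (2 * x) * this
  have hanti : StrictAntiOn (fun u : ℝ => π ^ 2 - u ^ 2 + 2 * u * cos u * sin u - sin u ^ 2)
      (Set.Icc 0 π) := by
    apply strictAntiOn_of_deriv_neg (convex_Icc 0 π)
    · exact fun x _ => (hd x).continuousAt.continuousWithinAt
    · intro x hx
      rw [interior_Icc] at hx
      rw [(hd x).deriv]
      have := sin_pos_of_pos_of_lt_pi hx.1 hx.2
      have := hx.1
      simp only [Left.neg_neg_iff]
      positivity
  have := hanti ⟨h0, hu.le⟩ ⟨pi_pos.le, le_rfl⟩ hu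
  simpa using this

/-- The inequality behind `|g'| ≤ 1`. -/
theorem sq_deriv_cosG_lt {θ : ℝ} (h0 : 0 < θ) (hθ : θ ≤ π) :
    ((π - θ) * sin θ / π) ^ 2 < 1 - cosG θ ^ 2 := by
  have h := sq_gap_pos (u := π - θ) (by linarith) (by linarith)
  rw [sin_pi_sub, cos_pi_sub] at h
  have hp := pi_pos
  have h1 : 1 - cosG θ ^ 2 - ((π - θ) * sin θ / π) ^ 2 =
      (π ^ 2 - (π - θ) ^ 2 + 2 * (π - θ) * -cos θ * sin θ - sin θ ^ 2) / π ^ 2 := by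
    unfold cosG
    field_simp
    have := sin_sq_add_cos_sq θ
    linear_combination (-(π - θ) ^ 2) * this
  have h2 := div_pos h (by positivity : 0 < π ^ 2)
  linarith

theorem cosG_zero : cosG 0 = 1 := by
  simp [cosG, pi_ne_zero]

theorem cosG_mem_Ioo {θ : ℝ} (h0 : 0 < θ) (hθ : θ ≤ π) : cosG θ ∈ Set.Ioo (-1) 1 := by
  have h := sq_deriv_cosG_lt h0 hθ
  have h2 : cosG θ ^ 2 < 1 := by nlinarith [sq_nonneg ((π - θ) * sin θ / π)]
  exact abs_lt.mp ((sq_lt_one_iff_abs_lt_one _).mp h2)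

theorem cosG_mem_Icc {θ : ℝ} (h0 : 0 ≤ θ) (hθ : θ ≤ π) : cosG θ ∈ Set.Icc (-1) 1 := by
  rcases h0.eq_or_lt with rfl | h0
  · rw [cosG_zero]; norm_num
  · exact Set.Ioo_subset_Icc_self (cosG_mem_Ioo h0 hθ)

theorem g_eq (θ : ℝ) : g θ = arccos (cosG θ) := rfl

theorem continuous_g : Continuous g := by
  unfold g
  fun_prop

theorem g_zero : g 0 = 0 := by
  rw [g_eq, cosG_zero, arccos_one]

theorem g_mem_Icc (θ : ℝ) : g θ ∈ Set.Icc 0 π := ⟨arccos_nonneg _, arccos_le_pi _⟩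

theorem cos_g {θ : ℝ} (h0 : 0 ≤ θ) (hθ : θ ≤ π) : cos (g θ) = cosG θ :=
  cos_arccos (cosG_mem_Icc h0 hθ).1 (cosG_mem_Icc h0 hθ).2

theorem hasDerivAt_g {θ : ℝ} (h0 : 0 < θ) (hθ : θ ≤ π) :
    HasDerivAt g (((π - θ) * sin θ / π) / √(1 - cosG θ ^ 2)) θ := by
  have h := cosG_mem_Ioo h0 hθ
  have h2 := (hasDerivAt_arccos h.1.ne' h.2.ne).comp θ (hasDerivAt_cosG θ)
  exact h2.congr_deriv (by ring)

theorem abs_deriv_g_le {θ : ℝ} (h0 : 0 < θ) (hθ : θ ≤ π) :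
    |((π - θ) * sin θ / π) / √(1 - cosG θ ^ 2)| ≤ 1 := by
  have h := sq_deriv_cosG_lt h0 hθ
  rw [abs_div, abs_of_nonneg (sqrt_nonneg _)]
  exact div_le_one_of_le₀ (abs_le_sqrt h.le) (sqrt_nonneg _)

/-- `g` is nonexpansive on `[0, π]`. -/
theorem abs_g_sub_le {s t : ℝ} (hs : s ∈ Set.Icc 0 π) (ht : t ∈ Set.Icc 0 π) :
    |g s - g t| ≤ |s - t| := by
  have hd : ∀ x ∈ interior (Set.Icc 0 π), 0 < x ∧ x ≤ π := by
    intro x hx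
    rw [interior_Icc] at hx
    exact ⟨hx.1, hx.2.le⟩
  -- From |g'| ≤ 1, g - id decreases and g + id increases. Derivatives are needed only in the open
  -- interval, which avoids θ = 0, where arccos is evaluated at 1.
  have hanti : AntitoneOn (fun x => g x - x) (Set.Icc 0 π) := by
    refine antitoneOn_of_deriv_nonpos (convex_Icc 0 π)
      (continuous_g.sub continuous_id).continuousOn ?_ ?_
    · intro x hx
      exact ((hasDerivAt_g (hd x hx).1 (hd x hx).2).sub
        (hasDerivAt_id x)).differentiableAt.differentiableWithinAt
    · intro x hx
      have := ((hasDerivAt_g (hd x hx).1 (hd x hx).2).sub (hasDerivAt_id x)).deriv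
      have h1 := (abs_le.mp (abs_deriv_g_le (hd x hx).1 (hd x hx).2)).2
      refine (le_of_eq this).trans ?_
      linarith
  have hmono : MonotoneOn (fun x => g x + x) (Set.Icc 0 π) := by
    refine monotoneOn_of_deriv_nonneg (convex_Icc 0 π)
      (continuous_g.add continuous_id).continuousOn ?_ ?_
    · intro x hx
      exact ((hasDerivAt_g (hd x hx).1 (hd x hx).2).add
        (hasDerivAt_id x)).differentiableAt.differentiableWithinAt
    · intro x hx
      have := ((hasDerivAt_g (hd x hx).1 (hd x hx).2).add (hasDerivAt_id x)).deriv
      have h1 := (abs_le.mp (abs_deriv_g_le (hd x hx).1 (hd x hx).2)).1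
      refine le_of_le_of_eq ?_ this.symm
      linarith
  rcases le_total s t with hst | hst
  · have h1 := hanti hs ht hst
    have h2 := hmono hs ht hst
    simp only at h1 h2
    rw [abs_of_nonpos (sub_nonpos.mpr hst), abs_le]
    constructor <;> linarith
  · have h1 := hanti ht hs hst
    have h2 := hmono ht hs hst
    simp only at h1 h2
    rw [abs_of_nonneg (sub_nonneg.mpr hst), abs_le]
    constructor <;> linarith

/-- Angles with close cosines are close. -/
theorem sq_angle_sub_le {s t : ℝ} (hs : s ∈ Set.Icc 0 π) (ht : t ∈ Set.Icc 0 π) :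
    2 * (s - t) ^ 2 ≤ π ^ 2 * |cos s - cos t| := by
  wlog hst : t ≤ s generalizing s t
  · have := this ht hs (le_of_not_ge hst)
    rwa [abs_sub_comm, ← neg_sq, neg_sub] at this
  -- In the product formula for cos s - cos t both sines are at least sin ((s - t)/2), which
  -- Jordan's inequality bounds below by (s - t)/π. The estimate is only quadratic in s - t; this is
  -- how ε in the cosines becomes √ε in the angles.
  have h1 : sin ((s - t) / 2) ≤ sin ((s + t) / 2) := by
    have h : sin ((s + t) / 2) - sin ((s - t) / 2) = 2 * sin (t / 2) * cos (s / 2) := by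
      rw [sin_sub_sin]
      ring_nf
    have h2 : 0 ≤ sin (t / 2) :=
      sin_nonneg_of_nonneg_of_le_pi (by linarith [ht.1]) (by linarith [ht.2, pi_pos])
    have h3 : 0 ≤ cos (s / 2) :=
      cos_nonneg_of_neg_pi_div_two_le_of_le (by linarith [hs.1, pi_pos]) (by linarith [hs.2])
    nlinarith [mul_nonneg h2 h3]
  have h2 : 2 / π * ((s - t) / 2) ≤ sin ((s - t) / 2) :=
    mul_le_sin (by linarith) (by linarith [hs.2, ht.1])
  have h0 : 0 ≤ 2 / π * ((s - t) / 2) :=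
    mul_nonneg (by positivity) (by linarith)
  have h3 : 2 * (2 / π * ((s - t) / 2)) ^ 2 ≤ |cos s - cos t| := by
    rw [cos_sub_cos, abs_mul, abs_mul, abs_neg, abs_two, abs_of_nonneg (h0.trans h2),
      abs_of_nonneg (h0.trans (h2.trans h1))]
    nlinarith [mul_self_le_mul_self h0 h2, mul_le_mul_of_nonneg_right h1 (h0.trans h2)]
  calc 2 * (s - t) ^ 2 = π ^ 2 * (2 * (2 / π * ((s - t) / 2)) ^ 2) := by
        field_simp
    _ ≤ _ := by gcongr

end AngleMap

/-! ### The matrix `Q` -/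

section MatrixQ

open Real InnerProductGeometry

variable {k : ℕ}

/-- M sends y to (‖y‖/‖x‖) x. That Q_{x,y} y stays in the span of x and y is what closes the layer
recursion. -/
theorem act_Q_right {x y : EuclideanSpace ℝ (Fin k)} (hx : x ≠ 0) (hy : y ≠ 0) :
    act (Q x y) y = ((π - angle x y) / (2 * π)) • y +
      (sin (angle x y) / (2 * π) * (‖y‖ / ‖x‖)) • x := by
  have h : act (swapMatrix x y) y = (‖y‖ / ‖x‖) • x := by
    have h1 : y = ‖y‖ • unitVec y := by
      rw [unitVec, smul_smul, mul_inv_cancel₀ (norm_ne_zero_iff.mpr hy), one_smul]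
    conv_lhs => rw [h1]
    rw [act_smul]
    have := act_swapMatrix_right hx hy
    rw [← h1, this, unitVec, smul_smul, div_eq_mul_inv]
  rw [Q, add_act, smul_act, smul_act, one_act, h, smul_smul]

theorem act_Q_self {x : EuclideanSpace ℝ (Fin k)} (hx : x ≠ 0) (z : EuclideanSpace ℝ (Fin k)) :
    act (Q x x) z = (1 / 2 : ℝ) • z := by
  rw [Q, add_act, smul_act, smul_act, one_act, angle_self hx]
  have : (π - 0) / (2 * π) = 1 / 2 := by
    have := pi_ne_zero
    field_simp
    ring
  rw [this]
  simp

/-- The origin of `g`: it is defined so that its cosine is the normalized form value xᵀ Q y. -/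
theorem inner_act_Q {x y : EuclideanSpace ℝ (Fin k)} (hx : x ≠ 0) (hy : y ≠ 0) :
    inner ℝ x (act (Q x y) y) = 1 / 2 * (‖x‖ * ‖y‖ * cos (g (angle x y))) := by
  rw [act_Q_right hx hy, inner_add_right, inner_smul_right, inner_smul_right,
    real_inner_self_eq_norm_sq, ← cos_angle_mul_norm_mul_norm,
    cos_g (angle_nonneg _ _) (angle_le_pi _ _), cosG]
  have := norm_ne_zero_iff.mpr hx
  have := pi_ne_zero
  field_simp

end MatrixQ

/-! ### One layer -/

section Layer

open Real InnerProductGeometry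

variable {a k : ℕ} {W : Matrix (Fin a) (Fin k) ℝ} {ε α : ℝ}

theorem transpose_plusPart_mul_plusPart (W : Matrix (Fin a) (Fin k) ℝ)
    (x y : EuclideanSpace ℝ (Fin k)) :
    (plusPart W x)ᵀ * plusPart W y = ∑ i : Fin a,
      if 0 < W i ⬝ᵥ x.ofLp ∧ 0 < W i ⬝ᵥ y.ofLp then Matrix.vecMulVec (W i) (W i) else 0 := by
  ext p q
  rw [Matrix.mul_apply, Matrix.sum_apply]
  refine Finset.sum_congr rfl fun i _ => ?_
  have h : ∀ z : EuclideanSpace ℝ (Fin k), act W z i = W i ⬝ᵥ z.ofLp := fun z => rfl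
  simp only [plusPart, Matrix.transpose_apply, Matrix.diagonal_mul, h]
  by_cases hx : 0 < W i ⬝ᵥ x.ofLp <;> by_cases hy : 0 < W i ⬝ᵥ y.ofLp <;>
    simp [hx, hy, Matrix.vecMulVec_apply]

theorem WDC.norm_act_sub_le (hW : WDC W ε α) {x y : EuclideanSpace ℝ (Fin k)} (hx : x ≠ 0)
    (hy : y ≠ 0) (z : EuclideanSpace ℝ (Fin k)) :
    ‖act (plusPart W x)ᵀ (act (plusPart W y) z) - α • act (Q x y) z‖ ≤ ε * ‖z‖ := by
  have h := hW x y hx hy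
  rw [← transpose_plusPart_mul_plusPart] at h
  rw [← mul_act, ← smul_act, ← sub_act]
  exact (norm_act_le_specNorm _ _).trans (mul_le_mul_of_nonneg_right h (norm_nonneg _))

/-- Pairing `W_{+,x}ᵀ W_{+,x} z ≈ z/2` with z. The vector z is independent of the x that fixes the
pattern; this freedom is what later yields bounds for transposed products. -/
theorem WDC.abs_sq_norm_sub_le (hW : WDC W ε 1) {x : EuclideanSpace ℝ (Fin k)} (hx : x ≠ 0)
    (z : EuclideanSpace ℝ (Fin k)) :
    |‖act (plusPart W x) z‖ ^ 2 - 1 / 2 * ‖z‖ ^ 2| ≤ ε * ‖z‖ ^ 2 := by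
  have h := hW.norm_act_sub_le hx hx z
  rw [act_Q_self hx, one_smul] at h
  have h1 : ‖act (plusPart W x) z‖ ^ 2 - 1 / 2 * ‖z‖ ^ 2 =
      inner ℝ z (act (plusPart W x)ᵀ (act (plusPart W x) z) - (1 / 2 : ℝ) • z) := by
    rw [inner_sub_right, inner_act_transpose, inner_smul_right, real_inner_self_eq_norm_sq,
      real_inner_self_eq_norm_sq]
  rw [h1]
  refine (abs_real_inner_le_norm _ _).trans ?_
  nlinarith [mul_le_mul_of_nonneg_left h (norm_nonneg z)]

theorem WDC.norm_act_le (hW : WDC W ε 1) (hε : 0 < ε) {x : EuclideanSpace ℝ (Fin k)}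
    (hx : x ≠ 0) (z : EuclideanSpace ℝ (Fin k)) :
    ‖act (plusPart W x) z‖ ≤ √(1 / 2 + ε) * ‖z‖ := by
  have h := (abs_le.mp (hW.abs_sq_norm_sub_le hx z)).2
  refine abs_le_of_sq_le_sq' ?_ (by positivity) |>.2
  rw [mul_pow, sq_sqrt (by positivity)]
  linarith

theorem WDC.le_norm_act (hW : WDC W ε 1) (hε : ε < 1 / 2) {x : EuclideanSpace ℝ (Fin k)}
    (hx : x ≠ 0) (z : EuclideanSpace ℝ (Fin k)) :
    √(1 / 2 - ε) * ‖z‖ ≤ ‖act (plusPart W x) z‖ := by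
  have h := (abs_le.mp (hW.abs_sq_norm_sub_le hx z)).1
  refine abs_le_of_sq_le_sq' ?_ (by positivity) |>.2
  rw [mul_pow, sq_sqrt (by linarith)]
  linarith

/-- A layer changes the angle between two vectors approximately as `g` does. -/
theorem WDC.abs_angle_sub_le (hW : WDC W ε 1) (hε : 0 < ε) (hε' : ε < 1 / 2)
    {x y : EuclideanSpace ℝ (Fin k)} (hx : x ≠ 0) (hy : y ≠ 0) :
    |angle (act (plusPart W x) x) (act (plusPart W y) y) - g (angle x y)| ≤ 5 * √ε := by
  set X := act (plusPart W x) x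
  set Y := act (plusPart W y) y
  set c := cos (angle X Y)
  set c' := cos (g (angle x y))
  have hN : 0 < ‖x‖ * ‖y‖ := by positivity
  have h1 : |c * (‖X‖ * ‖Y‖) - 1 / 2 * (‖x‖ * ‖y‖ * c')| ≤ ε * (‖x‖ * ‖y‖) := by
    rw [cos_angle_mul_norm_mul_norm, ← inner_act_Q hx hy, ← inner_act_transpose,
      ← inner_sub_right]
    have h := hW.norm_act_sub_le hx hy y
    rw [one_smul] at h
    refine (abs_real_inner_le_norm _ _).trans ?_
    nlinarith [mul_le_mul_of_nonneg_left h (norm_nonneg x)]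
  have hX1 : ‖X‖ ≤ √(1 / 2 + ε) * ‖x‖ := hW.norm_act_le hε hx x
  have hY1 : ‖Y‖ ≤ √(1 / 2 + ε) * ‖y‖ := hW.norm_act_le hε hy y
  have hX2 : √(1 / 2 - ε) * ‖x‖ ≤ ‖X‖ := hW.le_norm_act hε' hx x
  have hY2 : √(1 / 2 - ε) * ‖y‖ ≤ ‖Y‖ := hW.le_norm_act hε' hy y
  have h2 : |‖X‖ * ‖Y‖ - 1 / 2 * (‖x‖ * ‖y‖)| ≤ ε * (‖x‖ * ‖y‖) := by
    have hu := mul_le_mul hX1 hY1 (norm_nonneg _) (by positivity)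
    have hl := mul_le_mul hX2 hY2 (by positivity) (norm_nonneg _)
    have e1 := mul_self_sqrt (by linarith : 0 ≤ 1 / 2 + ε)
    have e2 := mul_self_sqrt (by linarith : 0 ≤ 1 / 2 - ε)
    have e3 : √(1 / 2 + ε) * ‖x‖ * (√(1 / 2 + ε) * ‖y‖) = (1 / 2 + ε) * (‖x‖ * ‖y‖) := by
      linear_combination (‖x‖ * ‖y‖) * e1
    have e4 : √(1 / 2 - ε) * ‖x‖ * (√(1 / 2 - ε) * ‖y‖) = (1 / 2 - ε) * (‖x‖ * ‖y‖) := by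
      linear_combination (‖x‖ * ‖y‖) * e2
    rw [abs_le]
    constructor <;> linarith
  -- The inner product and the product of norms are each off by at most ε‖x‖‖y‖, and c - c' carries
  -- the factor ½‖x‖‖y‖.
  have h3 : |c - c'| ≤ 4 * ε := by
    have hc : |c| ≤ 1 := abs_cos_le_one _
    have e : 1 / 2 * (‖x‖ * ‖y‖) * (c - c') =
        (c * (‖X‖ * ‖Y‖) - 1 / 2 * (‖x‖ * ‖y‖ * c')) -
          c * (‖X‖ * ‖Y‖ - 1 / 2 * (‖x‖ * ‖y‖)) := by ring
    have h4 : 1 / 2 * (‖x‖ * ‖y‖) * |c - c'| ≤ 2 * ε * (‖x‖ * ‖y‖) := by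
      have e0 : |1 / 2 * (‖x‖ * ‖y‖)| = 1 / 2 * (‖x‖ * ‖y‖) := abs_of_pos (by positivity)
      rw [← e0, ← abs_mul, e]
      refine (abs_sub _ _).trans ?_
      rw [abs_mul c]
      nlinarith [mul_le_mul hc h2 (abs_nonneg _) zero_le_one]
    by_contra! hlt
    nlinarith [mul_lt_mul_of_pos_left hlt hN]
  -- With π² ≤ 12 the squared angle error is at most 12 · 4ε / 2 = 24ε, below (5√ε)².
  have h5 := sq_angle_sub_le ⟨angle_nonneg X Y, angle_le_pi X Y⟩ (g_mem_Icc (angle x y))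
  refine abs_le_of_sq_le_sq ?_ (by positivity)
  rw [mul_pow, sq_sqrt hε.le]
  have hpi : π ^ 2 ≤ 12 := by nlinarith [pi_lt_d2, pi_pos]
  have := mul_le_mul hpi h3 (abs_nonneg _) (by norm_num)
  linarith

end Layer

/-! ### The limiting vector -/

section LimitVector

open Real InnerProductGeometry

variable {k : ℕ}

theorem thetaBar_succ (p q : EuclideanSpace ℝ (Fin k)) (i : ℕ) :
    thetaBar p q (i + 1) = g (thetaBar p q i) := by
  rw [thetaBar, thetaBar, Function.iterate_succ_apply']

theorem thetaBar_mem_Icc (p q : EuclideanSpace ℝ (Fin k)) (i : ℕ) :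
    thetaBar p q i ∈ Set.Icc 0 π := by
  cases i with
  | zero => exact ⟨angle_nonneg p q, angle_le_pi p q⟩
  | succ i =>
    rw [thetaBar_succ]
    exact g_mem_Icc _

theorem thetaBar_self {p : EuclideanSpace ℝ (Fin k)} (hp : p ≠ 0) (i : ℕ) :
    thetaBar p p i = 0 := by
  induction i with
  | zero => exact angle_self hp
  | succ i ih => rw [thetaBar_succ, ih, g_zero]

theorem two_pow_smul_tTilde (a : ℕ) (p q : EuclideanSpace ℝ (Fin k)) :
    (2 ^ a : ℝ) • tTilde a p q = (∏ i ∈ Finset.range a, (π - thetaBar p q i) / π) • q +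
      (∑ i ∈ Finset.range a, sin (thetaBar p q i) / π *
          (∏ j ∈ Finset.Ico (i + 1) a, (π - thetaBar p q j) / π) * (‖q‖ / ‖p‖)) • p := by
  rw [tTilde, smul_smul, mul_one_div_cancel (by positivity), one_smul, Finset.sum_smul]

theorem tTilde_zero (p q : EuclideanSpace ℝ (Fin k)) : tTilde 0 p q = q := by
  simp [tTilde]

/-- The exact recursion that the network follows approximately; the factor 2 per layer absorbs the ½
in Q. -/
theorem two_pow_smul_tTilde_succ (a : ℕ) (p q : EuclideanSpace ℝ (Fin k)) :
    (2 ^ (a + 1) : ℝ) • tTilde (a + 1) p q =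
      ((π - thetaBar p q a) / π) • ((2 ^ a : ℝ) • tTilde a p q) +
        (sin (thetaBar p q a) / π * (‖q‖ / ‖p‖)) • p := by
  rw [two_pow_smul_tTilde, two_pow_smul_tTilde, smul_add, smul_smul, smul_smul,
    Finset.prod_range_succ, Finset.sum_range_succ, Finset.Ico_self, Finset.prod_empty, add_smul,
    mul_comm (∏ i ∈ Finset.range a, _), mul_one, ← add_assoc, Finset.mul_sum]
  congr 3
  refine Finset.sum_congr rfl fun i hi => ?_
  rw [Finset.prod_Ico_succ_top (by simpa [Nat.succ_le_iff] using hi)]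
  ring

theorem tTilde_self {p : EuclideanSpace ℝ (Fin k)} (hp : p ≠ 0) (a : ℕ) :
    tTilde a p p = (1 / 2 ^ a : ℝ) • p := by
  simp [tTilde, thetaBar_self hp]

/-- Since sin θ ≤ θ, one step of the recursion has weights at most (π - θ)/π and θ/π, which sum to
1. -/
theorem norm_two_pow_smul_tTilde_le {p : EuclideanSpace ℝ (Fin k)} (hp : p ≠ 0)
    (q : EuclideanSpace ℝ (Fin k)) (a : ℕ) : ‖(2 ^ a : ℝ) • tTilde a p q‖ ≤ ‖q‖ := by
  induction a with
  | zero => simp [tTilde_zero]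
  | succ a ih =>
    obtain ⟨h0, h1⟩ := thetaBar_mem_Icc p q a
    have hs0 := sin_nonneg_of_nonneg_of_le_pi h0 h1
    have hs := sin_le h0
    have hpn := norm_pos_iff.mpr hp
    rw [two_pow_smul_tTilde_succ]
    refine (norm_add_le _ _).trans ?_
    rw [norm_smul, norm_smul ((sin _) / π * _), norm_of_nonneg (div_nonneg (by linarith) pi_pos.le),
      norm_of_nonneg (by positivity)]
    calc _ ≤ (π - thetaBar p q a) / π * ‖q‖ + thetaBar p q a / π * (‖q‖ / ‖p‖) * ‖p‖ := by
          have : 0 ≤ π - thetaBar p q a := by linarith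
          gcongr
      _ = ‖q‖ := by
          field_simp
          ring

theorem continuousAt_tTilde {k : ℕ} (a : ℕ) {p q : EuclideanSpace ℝ (Fin k)} (hp : p ≠ 0)
    (hq : q ≠ 0) : ContinuousAt (fun p' => tTilde a p' q) p := by
  have hth : ∀ i, ContinuousAt (fun p' => thetaBar p' q i) p := by
    intro i
    have h1 : ContinuousAt (fun p' => angle p' q) p :=
      (continuousAt_angle (x := (p, q)) hp hq).comp (f := fun p' => (p', q)) (by fun_prop)
    exact ((continuous_g.iterate i).continuousAt).comp h1
  have hn : ContinuousAt (fun p' : EuclideanSpace ℝ (Fin k) => ‖q‖ / ‖p'‖) p :=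
    continuousAt_const.div continuousAt_id.norm (norm_ne_zero_iff.mpr hp)
  have hfac : ∀ i, ContinuousAt (fun p' : EuclideanSpace ℝ (Fin k) =>
      (π - thetaBar p' q i) / π) p := fun i => ((hth i).const_sub π).div_const π
  have hsin : ∀ i, ContinuousAt (fun p' : EuclideanSpace ℝ (Fin k) =>
      sin (thetaBar p' q i) / π) p := fun i =>
    ContinuousAt.div_const (continuous_sin.continuousAt.comp (hth i)) π
  have hprod : ∀ s : Finset ℕ, ContinuousAt (fun p' : EuclideanSpace ℝ (Fin k) =>
      ∏ i ∈ s, (π - thetaBar p' q i) / π) p :=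
    fun s => tendsto_finsetProd _ fun i _ => hfac i
  unfold tTilde
  have h1 : ContinuousAt (fun p' : EuclideanSpace ℝ (Fin k) =>
      (∏ i ∈ Finset.range a, (π - thetaBar p' q i) / π) • q) p :=
    (hprod _).smul continuousAt_const
  have h2 : ContinuousAt (fun p' : EuclideanSpace ℝ (Fin k) =>
      ∑ i ∈ Finset.range a, (sin (thetaBar p' q i) / π *
        (∏ j ∈ Finset.Ico (i + 1) a, (π - thetaBar p' q j) / π) * (‖q‖ / ‖p'‖)) • p') p :=
    tendsto_finsetSum _ fun i _ => (((hsin i).mul (hprod _)).mul hn).smul continuousAt_id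
  exact (h1.add h2).const_smul (1 / 2 ^ a : ℝ)

theorem continuousAt_tVec {j k : ℕ} (a b ℓ : ℕ) (α : ℝ) {u₀ u : EuclideanSpace ℝ (Fin j)}
    {v₀ v : EuclideanSpace ℝ (Fin k)} (hu₀ : u₀ ≠ 0) (hv₀ : v₀ ≠ 0) (hu : u ≠ 0) (hv : v ≠ 0) :
    ContinuousAt (fun z : EuclideanSpace ℝ (Fin j) × EuclideanSpace ℝ (Fin k) =>
      tVec a b ℓ α u₀ v₀ z.1 z.2) (u, v) := by
  have h1 : ContinuousAt (fun z : EuclideanSpace ℝ (Fin j) × EuclideanSpace ℝ (Fin k) =>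
      tTilde a z.1 u₀) (u, v) :=
    ContinuousAt.comp (f := Prod.fst) (x := (u, v)) (continuousAt_tTilde a hu hu₀)
      continuousAt_fst
  have h2 : ContinuousAt (fun z : EuclideanSpace ℝ (Fin j) × EuclideanSpace ℝ (Fin k) =>
      tTilde b z.2 v₀) (u, v) :=
    ContinuousAt.comp (f := Prod.snd) (x := (u, v)) (continuousAt_tTilde b hv hv₀)
      continuousAt_snd
  unfold tVec
  refine ContinuousAt.sub ?_ ((continuousAt_const.mul
    (ContinuousAt.inner (𝕜 := ℝ) continuousAt_snd h2)).smul h1)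
  fun_prop

end LimitVector

/-! ### Several layers -/

namespace Net

open Real InnerProductGeometry

variable {d ℓ : ℕ} (N : Net d ℓ)

/-- The vector `x` after `k` hidden layers. -/
noncomputable def fwd (k : ℕ) (x : N.Latent) : EuclideanSpace ℝ (Fin (N.dim k)) :=
  act (N.hiddenLam k x) x

theorem act_hiddenLam_succ (k : ℕ) (x z : N.Latent) :
    act (N.hiddenLam (k + 1) x) z = act (plusPart (N.hidden k) (N.fwd k x))
      (act (N.hiddenLam k x) z) := by
  rw [hiddenLam, mul_act, fwd]

theorem fwd_zero (x : N.Latent) : N.fwd 0 x = x := by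
  rw [fwd, hiddenLam, one_act]

theorem fwd_succ (k : ℕ) (x : N.Latent) :
    N.fwd (k + 1) x = act (plusPart (N.hidden k) (N.fwd k x)) (N.fwd k x) :=
  N.act_hiddenLam_succ k x x

theorem act_hiddenLam_transpose_succ (k : ℕ) (x : N.Latent)
    (z : EuclideanSpace ℝ (Fin (N.dim (k + 1)))) :
    act (N.hiddenLam (k + 1) x)ᵀ z = act (N.hiddenLam k x)ᵀ
      (act (plusPart (N.hidden k) (N.fwd k x))ᵀ z) := by
  rw [hiddenLam, Matrix.transpose_mul, mul_act, fwd]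

variable {N} {ε : ℝ} {K : ℕ}

section Bounds

variable (hW : ∀ i < K, WDC (N.hidden i) ε 1) (hε : 0 < ε) (hε' : ε < 1 / 2)
include hW hε hε'

omit hε in
-- Nonvanishing is carried through the induction because the WDC speaks only of nonzero vectors.
theorem le_norm_fwd {k : ℕ} (hk : k ≤ K) {x : N.Latent} (hx : x ≠ 0) :
    √(1 / 2 - ε) ^ k * ‖x‖ ≤ ‖N.fwd k x‖ ∧ N.fwd k x ≠ 0 := by
  have hpos : 0 < √(1 / 2 - ε) := sqrt_pos.mpr (by linarith)
  induction k with
  | zero => simpa [fwd_zero] using hx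
  | succ k ih =>
    obtain ⟨h1, h2⟩ := ih (by omega)
    have h3 := (hW k hk).le_norm_act hε' h2 (N.fwd k x)
    rw [← fwd_succ] at h3
    have h4 : √(1 / 2 - ε) ^ (k + 1) * ‖x‖ ≤ ‖N.fwd (k + 1) x‖ := by
      rw [pow_succ', mul_assoc]
      exact (mul_le_mul_of_nonneg_left h1 hpos.le).trans h3
    refine ⟨h4, norm_pos_iff.mp (lt_of_lt_of_le ?_ h4)⟩
    have := norm_pos_iff.mpr hx
    positivity

theorem norm_act_hiddenLam_le {k : ℕ} (hk : k ≤ K) {x : N.Latent} (hx : x ≠ 0) (z : N.Latent) :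
    ‖act (N.hiddenLam k x) z‖ ≤ √(1 / 2 + ε) ^ k * ‖z‖ := by
  induction k with
  | zero => simp [hiddenLam, one_act]
  | succ k ih =>
    rw [act_hiddenLam_succ, pow_succ', mul_assoc]
    exact ((hW k hk).norm_act_le hε (le_norm_fwd hW hε' (by omega) hx).2 _).trans
      (mul_le_mul_of_nonneg_left (ih (by omega)) (sqrt_nonneg _))

theorem norm_act_hiddenLam_transpose_le {k : ℕ} (hk : k ≤ K) {x : N.Latent} (hx : x ≠ 0)
    (z : EuclideanSpace ℝ (Fin (N.dim k))) :
    ‖act (N.hiddenLam k x)ᵀ z‖ ≤ √(1 / 2 + ε) ^ k * ‖z‖ :=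
  norm_act_transpose_le (by positivity) (norm_act_hiddenLam_le hW hε hε' hk hx) z

theorem norm_fwd_le {k : ℕ} (hk : k ≤ K) {x : N.Latent} (hx : x ≠ 0) :
    ‖N.fwd k x‖ ≤ √(1 / 2 + ε) ^ k * ‖x‖ :=
  norm_act_hiddenLam_le hW hε hε' hk hx x

omit hW hε' in
theorem two_pow_mul_sqrt_pow (k : ℕ) :
    (2 : ℝ) ^ k * (√(1 / 2 + ε) ^ k * √(1 / 2 + ε) ^ k) = (1 + 2 * ε) ^ k := by
  rw [← mul_pow, ← mul_pow, mul_self_sqrt (by positivity)]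
  ring

/-- Error made by a matrix close to zero between the `k`-th layers. -/
theorem two_pow_mul_norm_le {k : ℕ} (hk : k ≤ K) {h x : N.Latent} (hh : h ≠ 0) (hx : x ≠ 0)
    {t : ℝ} (ht : 0 ≤ t) {z : EuclideanSpace ℝ (Fin (N.dim k))} (hz : ‖z‖ ≤ t * ‖N.fwd k x‖) :
    (2 : ℝ) ^ k * ‖act (N.hiddenLam k h)ᵀ z‖ ≤ (1 + 2 * ε) ^ k * t * ‖x‖ := by
  have h1 := norm_act_hiddenLam_transpose_le hW hε hε' hk hh z
  have h2 := norm_fwd_le hW hε hε' hk hx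
  calc (2 : ℝ) ^ k * ‖act (N.hiddenLam k h)ᵀ z‖
      ≤ 2 ^ k * (√(1 / 2 + ε) ^ k * (t * (√(1 / 2 + ε) ^ k * ‖x‖))) := by
        have := hz.trans (mul_le_mul_of_nonneg_left h2 ht)
        gcongr
        exact h1.trans (by gcongr)
    _ = 2 ^ k * (√(1 / 2 + ε) ^ k * √(1 / 2 + ε) ^ k) * t * ‖x‖ := by ring
    _ = _ := by rw [two_pow_mul_sqrt_pow hε]

theorem norm_fwd_div_le {k : ℕ} (hk : k ≤ K) (hε4 : ε < 1 / 4) {h x : N.Latent} (hh : h ≠ 0)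
    (hx : x ≠ 0) : ‖N.fwd k x‖ / ‖N.fwd k h‖ ≤ (1 + 4 * ε) ^ k * (‖x‖ / ‖h‖) := by
  have h1 := norm_fwd_le hW hε hε' hk hx
  obtain ⟨h2, h3⟩ := le_norm_fwd hW hε' hk hh
  have hp := norm_pos_iff.mpr h3
  have hp' := norm_pos_iff.mpr hh
  -- After squaring, the inequality reduces to 16ε³ ≤ 2ε, true for ε < 1/4.
  have h4 : √(1 / 2 + ε) ≤ (1 + 4 * ε) * √(1 / 2 - ε) := by
    refine abs_le_of_sq_le_sq' ?_ (by positivity) |>.2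
    rw [mul_pow, sq_sqrt (by linarith), sq_sqrt (by linarith)]
    nlinarith [mul_pos hε (sub_pos.mpr hε4), mul_pos hε hε]
  rw [div_le_iff₀ hp]
  calc ‖N.fwd k x‖ ≤ ((1 + 4 * ε) * √(1 / 2 - ε)) ^ k * ‖x‖ := h1.trans (by gcongr)
    _ = (1 + 4 * ε) ^ k * (‖x‖ / ‖h‖) * (√(1 / 2 - ε) ^ k * ‖h‖) := by
        rw [mul_pow]
        field_simp
    _ ≤ _ := by gcongr

/-- Each layer contributes 5√ε, and nonexpansiveness of `g` keeps the inherited error from growing.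
-/
theorem abs_angle_fwd_sub_thetaBar_le {k : ℕ} (hk : k ≤ K) {h x : N.Latent} (hh : h ≠ 0)
    (hx : x ≠ 0) : |angle (N.fwd k h) (N.fwd k x) - thetaBar h x k| ≤ 5 * k * √ε := by
  induction k with
  | zero => simp [fwd_zero, thetaBar]
  | succ k ih =>
    have h1 := (hW k hk).abs_angle_sub_le hε hε' (le_norm_fwd hW hε' (k := k) (by omega) hh).2
      (le_norm_fwd hW hε' (k := k) (by omega) hx).2
    have h2 := (abs_g_sub_le ⟨angle_nonneg (N.fwd k h) (N.fwd k x), angle_le_pi _ _⟩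
      (thetaBar_mem_Icc h x k)).trans (ih (by omega))
    rw [fwd_succ, fwd_succ, thetaBar_succ]
    refine (abs_sub_le _ _ _).trans ((add_le_add h1 h2).trans (le_of_eq ?_))
    push_cast
    ring

theorem norm_transpose_fwd_self_sub_le {k : ℕ} (hk : k ≤ K) {h : N.Latent} (hh : h ≠ 0) :
    ‖(2 ^ k : ℝ) • act (N.hiddenLam k h)ᵀ (N.fwd k h) - h‖ ≤ ((1 + 2 * ε) ^ k - 1) * ‖h‖ := by
  induction k with
  | zero => simp [fwd_zero, hiddenLam, one_act]
  | succ k ih =>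
    have h0 := (le_norm_fwd hW hε' (k := k) (by omega) hh).2
    have h1 := (hW k hk).norm_act_sub_le h0 h0 (N.fwd k h)
    rw [one_smul, act_Q_self h0, ← fwd_succ] at h1
    have h2 := two_pow_mul_norm_le hW hε hε' (k := k) (by omega) hh hh hε.le h1
    have e : (2 ^ (k + 1) : ℝ) • act (N.hiddenLam (k + 1) h)ᵀ (N.fwd (k + 1) h) - h =
        (2 : ℝ) • ((2 ^ k : ℝ) • act (N.hiddenLam k h)ᵀ
          (act (plusPart (N.hidden k) (N.fwd k h))ᵀ (N.fwd (k + 1) h) -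
            (1 / 2 : ℝ) • N.fwd k h)) +
        ((2 ^ k : ℝ) • act (N.hiddenLam k h)ᵀ (N.fwd k h) - h) := by
      rw [act_hiddenLam_transpose_succ, act_sub, act_smul]
      module
    rw [e]
    refine (norm_add_le _ _).trans ?_
    rw [norm_smul, norm_smul, norm_of_nonneg (by positivity : (0 : ℝ) ≤ 2),
      norm_of_nonneg (by positivity : (0 : ℝ) ≤ 2 ^ k)]
    -- The sum telescopes: 2ε(1 + 2ε)ᵏ + (1 + 2ε)ᵏ - 1 = (1 + 2ε)ᵏ⁺¹ - 1.
    refine (add_le_add (mul_le_mul_of_nonneg_left h2 zero_le_two) (ih (by omega))).trans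
      (le_of_eq ?_)
    ring

end Bounds

end Net

/-! ### Comparison of the pulled-back layers with `tTilde` -/

namespace Net

open Real InnerProductGeometry

theorem one_add_pow_le {t : ℝ} {k : ℕ} (ht : 0 ≤ t) (hk : k * t ≤ 1) :
    (1 + t) ^ k ≤ 1 + 2 * (k * t) := by
  have h0 : 0 ≤ k * t := by positivity
  have h1 : (1 + t) ^ k ≤ exp (k * t) := by
    rw [exp_nat_mul]
    have := add_one_le_exp t
    gcongr
    linarith
  have h2 := (abs_le.mp (abs_exp_sub_one_sub_id_le (abs_le.mpr ⟨by linarith, hk⟩))).2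
  nlinarith

variable {d ℓ : ℕ} {N : Net d ℓ} {ε : ℝ} {K : ℕ}

/-- The network's counterpart of `two_pow_smul_tTilde_succ`, with true angle, true norm ratio and
pulled-back vectors, so that the two can be compared term by term. -/
theorem two_pow_smul_act_Q {k : ℕ} {h x : N.Latent} (hh : N.fwd k h ≠ 0) (hx : N.fwd k x ≠ 0) :
    (2 ^ (k + 1) : ℝ) • act (N.hiddenLam k h)ᵀ
        (act (Q (N.fwd k h) (N.fwd k x)) (N.fwd k x)) =
      ((π - angle (N.fwd k h) (N.fwd k x)) / π) •
          ((2 ^ k : ℝ) • act (N.hiddenLam k h)ᵀ (N.fwd k x)) +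
        (sin (angle (N.fwd k h) (N.fwd k x)) / π * (‖N.fwd k x‖ / ‖N.fwd k h‖)) •
          ((2 ^ k : ℝ) • act (N.hiddenLam k h)ᵀ (N.fwd k h)) := by
  rw [act_Q_right hh hx, act_add, act_smul, act_smul]
  have := pi_ne_zero
  rw [smul_add, smul_smul, smul_smul, smul_smul, smul_smul]
  congr 2
  · field_simp
    ring
  · field_simp
    ring

variable (hW : ∀ i < K, WDC (N.hidden i) ε 1) (hε : 0 < ε) (hK : 16 * K * √ε ≤ 1)
  (hε16 : 16 * √ε ≤ 1)
include hW hε hK hε16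

theorem norm_div_smul_sub_le {k : ℕ} (hk : k ≤ K) {h x : N.Latent} (hh : h ≠ 0) (hx : x ≠ 0) :
    ‖(‖N.fwd k x‖ / ‖N.fwd k h‖) • ((2 ^ k : ℝ) • act (N.hiddenLam k h)ᵀ (N.fwd k h)) -
      (‖x‖ / ‖h‖) • h‖ ≤ 2 * √ε * ‖x‖ := by
  have hsq := mul_self_sqrt hε.le
  have hs0 := sqrt_pos.mpr hε
  have hε4 : ε < 1 / 4 := by nlinarith
  have hε2 : ε < 1 / 2 := by linarith
  have hkK : (k : ℝ) ≤ K := by exact_mod_cast hk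
  -- Compounded norm errors are of order kε; the smallness of k√ε absorbs them into √ε.
  have hkε : 16 * (k * ε) ≤ √ε := by
    have : 16 * k * √ε ≤ 1 := le_trans (by gcongr) hK
    nlinarith
  have hA := one_add_pow_le (t := 4 * ε) (k := k) (by positivity) (by nlinarith)
  have hA1 : 1 ≤ (1 + 4 * ε) ^ k := one_le_pow₀ (by linarith)
  have hA2 : (1 + 2 * ε) ^ k ≤ (1 + 4 * ε) ^ k := by gcongr; norm_num
  set A := (1 + 4 * ε) ^ k
  have hP := norm_transpose_fwd_self_sub_le hW hε hε2 hk hh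
  set P := (2 ^ k : ℝ) • act (N.hiddenLam k h)ᵀ (N.fwd k h)
  have hr1 := norm_fwd_div_le hW hε hε2 hk hε4 hh hx
  have hr2 := norm_fwd_div_le hW hε hε2 hk hε4 hx hh
  have hpx := norm_pos_iff.mpr (le_norm_fwd hW hε2 hk hx).2
  have hph := norm_pos_iff.mpr (le_norm_fwd hW hε2 hk hh).2
  have hx0 := norm_pos_iff.mpr hx
  have hh0 := norm_pos_iff.mpr hh
  set ρ := ‖N.fwd k x‖ / ‖N.fwd k h‖ with hρ
  set r := ‖x‖ / ‖h‖ with hr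
  have hρ0 : 0 < ρ := by positivity
  have hr0 : 0 < r := by positivity
  -- The lower bound on ρ is the upper bound with h and x exchanged.
  have hr2' : r ≤ A * ρ := by
    have e1 : ‖N.fwd k h‖ / ‖N.fwd k x‖ = ρ⁻¹ := by rw [hρ, inv_div]
    have e2 : ‖h‖ / ‖x‖ = r⁻¹ := by rw [hr, inv_div]
    rw [e1, e2, ← div_eq_mul_inv, le_div_iff₀ hr0, inv_mul_le_iff₀ hρ0] at hr2
    linarith
  have hdiff : |ρ - r| ≤ (A - 1) * r := by
    rw [abs_le]
    constructor
    · rcases le_total ρ r with h | h <;> nlinarith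
    · linarith
  have e : ρ • P - r • h = ρ • (P - h) + (ρ - r) • h := by module
  have hrh : r * ‖h‖ = ‖x‖ := div_mul_cancel₀ _ hh0.ne'
  rw [e]
  refine (norm_add_le _ _).trans ?_
  rw [norm_smul, norm_smul, norm_of_nonneg hρ0.le, norm_eq_abs]
  -- Here A ≤ 1 + 8kε ≤ 1 + √ε/2, hence A² - 1 ≤ √ε + ε/4 ≤ 2√ε.
  calc ρ * ‖P - h‖ + |ρ - r| * ‖h‖
      ≤ A * r * ((A - 1) * ‖h‖) + (A - 1) * r * ‖h‖ := by
        have : ‖P - h‖ ≤ (A - 1) * ‖h‖ := hP.trans (by gcongr)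
        gcongr
    _ = (A ^ 2 - 1) * ‖x‖ := by rw [← hrh]; ring
    _ ≤ _ := by
        gcongr
        nlinarith

theorem norm_act_Q_sub_tTilde_le_add {k : ℕ} (hk : k ≤ K) {h x : N.Latent} (hh : h ≠ 0)
    (hx : x ≠ 0) :
    ‖(2 ^ (k + 1) : ℝ) • act (N.hiddenLam k h)ᵀ (act (Q (N.fwd k h) (N.fwd k x)) (N.fwd k x)) -
        (2 ^ (k + 1) : ℝ) • tTilde (k + 1) h x‖ ≤
      ‖(2 ^ k : ℝ) • act (N.hiddenLam k h)ᵀ (N.fwd k x) - (2 ^ k : ℝ) • tTilde k h x‖ +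
        (4 * k + 1) * √ε * ‖x‖ := by
  have hsq := mul_self_sqrt hε.le
  have hs0 := sqrt_pos.mpr hε
  have hε2 : ε < 1 / 2 := by nlinarith
  have hx0 := norm_pos_iff.mpr hx
  have hh0 := norm_pos_iff.mpr hh
  have hth := abs_angle_fwd_sub_thetaBar_le hW hε hε2 hk hh hx
  have hB := norm_div_smul_sub_le hW hε hK hε16 hk hh hx
  have hτ := norm_two_pow_smul_tTilde_le hh x k
  rw [two_pow_smul_act_Q (le_norm_fwd hW hε2 hk hh).2 (le_norm_fwd hW hε2 hk hx).2,
    two_pow_smul_tTilde_succ]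
  have hθ0 := angle_nonneg (N.fwd k h) (N.fwd k x)
  have hθπ := angle_le_pi (N.fwd k h) (N.fwd k x)
  have hsin := (abs_sin_sub_sin_le (angle (N.fwd k h) (N.fwd k x)) (thetaBar h x k)).trans hth
  set θ := angle (N.fwd k h) (N.fwd k x)
  set θ' := thetaBar h x k
  set Γ := (2 ^ k : ℝ) • act (N.hiddenLam k h)ᵀ (N.fwd k x)
  set P := (2 ^ k : ℝ) • act (N.hiddenLam k h)ᵀ (N.fwd k h)
  set τ := (2 ^ k : ℝ) • tTilde k h x
  set ρ := ‖N.fwd k x‖ / ‖N.fwd k h‖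
  -- One term for each discrepancy: inherited error, angle, pulled-back h with norm ratio, sine. As
  -- π > 3, the last three cost at most 5k/3, 2/3 and 5k/3 times √ε‖x‖, within 4k + 1.
  have e : ((π - θ) / π) • Γ + (sin θ / π * ρ) • P -
      (((π - θ') / π) • τ + (sin θ' / π * (‖x‖ / ‖h‖)) • h) =
      ((π - θ) / π) • (Γ - τ) + ((θ' - θ) / π) • τ +
        (sin θ / π) • (ρ • P - (‖x‖ / ‖h‖) • h) +
        ((sin θ - sin θ') / π * (‖x‖ / ‖h‖)) • h := by module
  rw [e]
  refine (norm_add_le _ _).trans ?_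
  refine (add_le_add_left ((norm_add_le _ _).trans
    (add_le_add_left (norm_add_le _ _) _)) _).trans ?_
  rw [norm_smul _ (Γ - τ), norm_smul _ τ, norm_smul (sin θ / π), norm_smul _ h, norm_eq_abs,
    norm_eq_abs, norm_eq_abs,
    norm_eq_abs, abs_mul, abs_div, abs_div, abs_div, abs_div, abs_of_pos pi_pos, abs_sub_comm θ',
    abs_of_pos (div_pos hx0 hh0), mul_assoc _ _ ‖h‖, div_mul_cancel₀ _ hh0.ne']
  have hp3 := pi_gt_three
  have t1 : |π - θ| / π * ‖Γ - τ‖ ≤ ‖Γ - τ‖ := by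
    refine mul_le_of_le_one_left (norm_nonneg _) (div_le_one_of_le₀ ?_ pi_pos.le)
    rw [abs_of_nonneg (by linarith)]
    linarith
  have t2 : |θ - θ'| / π * ‖τ‖ ≤ 5 * k * √ε / 3 * ‖x‖ := by gcongr
  have t3 : |sin θ| / π * ‖ρ • P - (‖x‖ / ‖h‖) • h‖ ≤ 1 / 3 * (2 * √ε * ‖x‖) := by
    have := abs_sin_le_one θ
    gcongr
  have t4 : |sin θ - sin θ'| / π * ‖x‖ ≤ 5 * k * √ε / 3 * ‖x‖ := by gcongr
  have hk0 : 0 ≤ k * √ε * ‖x‖ := by positivity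
  have hk1 : 0 ≤ √ε * ‖x‖ := by positivity
  linarith

/-- A layer costs (4k + 1)√ε for the recursion and √ε for replacing the layer by Q; 4k + 2 is the
increment of 2k². -/
theorem norm_transpose_fwd_sub_tTilde_le {k : ℕ} (hk : k ≤ K) {h x : N.Latent} (hh : h ≠ 0)
    (hx : x ≠ 0) :
    ‖(2 ^ k : ℝ) • act (N.hiddenLam k h)ᵀ (N.fwd k x) - (2 ^ k : ℝ) • tTilde k h x‖ ≤
      2 * k ^ 2 * √ε * ‖x‖ := by
  have hsq := mul_self_sqrt hε.le
  have hs0 := sqrt_pos.mpr hε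
  have hε2 : ε < 1 / 2 := by nlinarith
  induction k with
  | zero => simp [fwd_zero, hiddenLam, one_act, tTilde_zero]
  | succ k ih =>
    have hkK : (k : ℝ) ≤ K := by exact_mod_cast (Nat.le_of_succ_le hk)
    have hkε : 16 * (k * ε) ≤ √ε := by
      have : 16 * k * √ε ≤ 1 := le_trans (by gcongr) hK
      nlinarith
    have hA := one_add_pow_le (t := 2 * ε) (k := k) (by positivity) (by nlinarith)
    have h0 := (le_norm_fwd hW hε2 (k := k) (by omega) hh).2
    have h1 := (le_norm_fwd hW hε2 (k := k) (by omega) hx).2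
    have h2 := (hW k hk).norm_act_sub_le h0 h1 (N.fwd k x)
    rw [one_smul, ← fwd_succ] at h2
    have h3 := two_pow_mul_norm_le hW hε hε2 (k := k) (by omega) hh hx hε.le h2
    have h4 := norm_act_Q_sub_tTilde_le_add hW hε hK hε16 (k := k) (by omega) hh hx
    have h5 := ih (by omega)
    have e : (2 ^ (k + 1) : ℝ) • act (N.hiddenLam (k + 1) h)ᵀ (N.fwd (k + 1) x) -
          (2 ^ (k + 1) : ℝ) • tTilde (k + 1) h x =
        (2 : ℝ) • ((2 ^ k : ℝ) • act (N.hiddenLam k h)ᵀ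
          (act (plusPart (N.hidden k) (N.fwd k h))ᵀ (N.fwd (k + 1) x) -
            act (Q (N.fwd k h) (N.fwd k x)) (N.fwd k x))) +
        ((2 ^ (k + 1) : ℝ) • act (N.hiddenLam k h)ᵀ
            (act (Q (N.fwd k h) (N.fwd k x)) (N.fwd k x)) -
          (2 ^ (k + 1) : ℝ) • tTilde (k + 1) h x) := by
      rw [act_hiddenLam_transpose_succ, act_sub]
      module
    rw [e]
    refine (norm_add_le _ _).trans ?_
    rw [norm_smul, norm_smul, norm_of_nonneg (by positivity : (0 : ℝ) ≤ 2),
      norm_of_nonneg (by positivity : (0 : ℝ) ≤ 2 ^ k)]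
    have h6 : 2 * ((1 + 2 * ε) ^ k * ε * ‖x‖) ≤ √ε * ‖x‖ := by
      have : 2 * ((1 + 2 * ε) ^ k * ε) ≤ √ε := by nlinarith
      calc _ = 2 * ((1 + 2 * ε) ^ k * ε) * ‖x‖ := by ring
        _ ≤ _ := by gcongr
    push_cast
    linarith

/-- The form used at the last layer, where Q is supplied by the joint-WDC. -/
theorem norm_transpose_act_Q_sub_tTilde_le {k : ℕ} (hk : k ≤ K) {h x : N.Latent} (hh : h ≠ 0)
    (hx : x ≠ 0) :
    ‖(2 ^ (k + 1) : ℝ) • act (N.hiddenLam k h)ᵀ (act (Q (N.fwd k h) (N.fwd k x)) (N.fwd k x)) -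
        (2 ^ (k + 1) : ℝ) • tTilde (k + 1) h x‖ ≤ 2 * (k + 1 : ℕ) ^ 2 * √ε * ‖x‖ := by
  have h1 := norm_act_Q_sub_tTilde_le_add hW hε hK hε16 hk hh hx
  have h2 := norm_transpose_fwd_sub_tTilde_le hW hε hK hε16 hk hh hx
  have h3 : 0 ≤ √ε * ‖x‖ := by positivity
  push_cast
  linarith

end Net

/-! ### The cross terms -/

section CrossTerm

open Real InnerProductGeometry

variable {d s ℓ : ℕ} {N₁ : Net d ℓ} {N₂ : Net s ℓ} {ε α : ℝ}

theorem HalfJointWDC.norm_act_sub_le {a b : ℕ} {B : Matrix (Fin ℓ) (Fin a) ℝ}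
    {C : Matrix (Fin ℓ) (Fin b) ℝ} (hBC : HalfJointWDC B C ε α)
    {h x : EuclideanSpace ℝ (Fin a)} {m y : EuclideanSpace ℝ (Fin b)}
    (hh : h ≠ 0) (hx : x ≠ 0) (hm : m ≠ 0) (hy : y ≠ 0) (z : EuclideanSpace ℝ (Fin a)) :
    ‖act ((plusPart B h)ᵀ *
          Matrix.diagonal (hadamard (act (plusPart C m) m) (act (plusPart C y) y)).ofLp *
          plusPart B x) z - (α / ℓ * inner ℝ m (act (Q m y) y)) • act (Q h x) z‖ ≤
      ε / ℓ * ‖m‖ * ‖y‖ * ‖z‖ := by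
  rw [← smul_act, ← sub_act]
  exact (norm_act_le_specNorm _ _).trans
    (mul_le_mul_of_nonneg_right (hBC h x m y hh hx hm hy) (norm_nonneg _))

namespace Net

theorem lam_eq (N : Net d ℓ) (x : N.Latent) :
    N.lam x = plusPart N.outer (N.fwd (d - 1) x) * N.hiddenLam (d - 1) x := rfl

theorem act_lam (N : Net d ℓ) (x : N.Latent) :
    act (N.lam x) x = act (plusPart N.outer (N.fwd (d - 1) x)) (N.fwd (d - 1) x) := by
  rw [lam_eq, mul_act]
  rfl

end Net

/-- Isolates the two outer matrices, evaluated at hidden outputs, as the joint-WDC requires. -/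
theorem crossTerm_eq (h x : N₁.Latent) (m y : N₂.Latent) :
    crossTerm N₁ N₂ h x m y = act (N₁.hiddenLam (d - 1) h)ᵀ
      (act ((plusPart N₁.outer (N₁.fwd (d - 1) h))ᵀ *
        Matrix.diagonal (hadamard
          (act (plusPart N₂.outer (N₂.fwd (s - 1) m)) (N₂.fwd (s - 1) m))
          (act (plusPart N₂.outer (N₂.fwd (s - 1) y)) (N₂.fwd (s - 1) y))).ofLp *
        plusPart N₁.outer (N₁.fwd (d - 1) x)) (N₁.fwd (d - 1) x)) := by
  rw [crossTerm, N₂.act_lam, N₂.act_lam, N₁.lam_eq, N₁.lam_eq, Matrix.transpose_mul, Net.fwd]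
  simp only [mul_act]
  rfl

theorem two_mul_sq_add_le {d s : ℕ} (hd : 2 ≤ d) (hs : 2 ≤ s) :
    4 * (s : ℝ) ^ 2 + 2 * (d : ℝ) ^ 2 + 1 ≤ 208 * d ^ 3 * s ^ 3 := by
  have h1 : (2 : ℝ) ≤ d := by exact_mod_cast hd
  have h2 : (2 : ℝ) ≤ s := by exact_mod_cast hs
  have h3 : (1 : ℝ) ≤ d ^ 3 := one_le_pow₀ (by linarith)
  have h4 : (1 : ℝ) ≤ s ^ 3 := one_le_pow₀ (by linarith)
  have h5 : (d : ℝ) ^ 2 ≤ d ^ 3 := pow_le_pow_right₀ (by linarith) (by norm_num)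
  have h6 : (s : ℝ) ^ 2 ≤ s ^ 3 := pow_le_pow_right₀ (by linarith) (by norm_num)
  have h7 : (d : ℝ) ^ 3 ≤ d ^ 3 * s ^ 3 := le_mul_of_one_le_right (by linarith) h4
  have h8 : (s : ℝ) ^ 3 ≤ d ^ 3 * s ^ 3 := le_mul_of_one_le_left (by linarith) h3
  linarith

theorem norm_inner_smul_sub_inner_smul_le {E F : Type*} [NormedAddCommGroup E] [NormedSpace ℝ E]
    [NormedAddCommGroup F] [InnerProductSpace ℝ F] {m T t : F} {U u : E} {p q M X : ℝ}
    (hp : 0 ≤ p) (hM : 0 ≤ M) (hT : ‖T - t‖ ≤ p * M) (ht : ‖t‖ ≤ M)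
    (hU : ‖U - u‖ ≤ q * X) (hu : ‖u‖ ≤ X) :
    ‖(inner ℝ m T : ℝ) • U - (inner ℝ m t : ℝ) • u‖ ≤ (p * (1 + q) + q) * (X * ‖m‖ * M) := by
  have hU' : ‖U‖ ≤ (1 + q) * X := by
    have := norm_add_le (U - u) u
    rw [sub_add_cancel] at this
    linarith
  have e : (inner ℝ m T : ℝ) • U - (inner ℝ m t : ℝ) • u =
      (inner ℝ m (T - t) : ℝ) • U + (inner ℝ m t : ℝ) • (U - u) := by
    rw [inner_sub_right]
    module
  rw [e]
  refine (norm_add_le _ _).trans ?_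
  rw [norm_smul, norm_smul]
  calc ‖(inner ℝ m (T - t) : ℝ)‖ * ‖U‖ + ‖(inner ℝ m t : ℝ)‖ * ‖U - u‖
      ≤ ‖m‖ * (p * M) * ((1 + q) * X) + ‖m‖ * M * (q * X) := by
        have h1 : ‖(inner ℝ m (T - t) : ℝ)‖ ≤ ‖m‖ * (p * M) :=
          (norm_inner_le_norm _ _).trans (by gcongr)
        have h2 : ‖(inner ℝ m t : ℝ)‖ ≤ ‖m‖ * M := (norm_inner_le_norm _ _).trans (by gcongr)
        gcongr
    _ = _ := by ring

theorem norm_crossTerm_sub_le (hd : 2 ≤ d) (hs : 2 ≤ s) (hε : 0 < ε)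
    (hdε : 16 * (d : ℝ) ^ 2 * √ε ≤ 1) (hsε : 16 * (s : ℝ) ^ 2 * √ε ≤ 1) (hα : 0 ≤ α)
    (hα' : α ≤ 1) (hN₁ : ∀ i < d - 1, WDC (N₁.hidden i) ε 1)
    (hN₂ : ∀ i < s - 1, WDC (N₂.hidden i) ε 1) (hjoint : HalfJointWDC N₁.outer N₂.outer ε α)
    {h x : N₁.Latent} {m y : N₂.Latent} (hh : h ≠ 0) (hx : x ≠ 0) (hm : m ≠ 0) (hy : y ≠ 0) :
    ‖crossTerm N₁ N₂ h x m y - (α / ℓ * inner ℝ m (tTilde s m y)) • tTilde d h x‖ ≤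
      208 * d ^ 3 * s ^ 3 * √ε / (2 ^ (d + s) * ℓ) * ‖x‖ * ‖m‖ * ‖y‖ := by
  obtain ⟨a, rfl⟩ : ∃ a, d = a + 1 := ⟨d - 1, by omega⟩
  obtain ⟨b, rfl⟩ : ∃ b, s = b + 1 := ⟨s - 1, by omega⟩
  have hnum := two_mul_sq_add_le hd hs
  rw [crossTerm_eq]
  simp only [Nat.add_sub_cancel] at hN₁ hN₂ ⊢
  have hsq := mul_self_sqrt hε.le
  have hs0 := sqrt_pos.mpr hε
  have small : ∀ c : ℕ, 16 * ((c + 1 : ℕ) : ℝ) ^ 2 * √ε ≤ 1 →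
      16 * (c : ℝ) * √ε ≤ 1 ∧ 16 * √ε ≤ 1 := by
    intro c hc
    have h1 : (c : ℝ) ≤ ((c + 1 : ℕ) : ℝ) ^ 2 := by push_cast; nlinarith [sq_nonneg (c : ℝ)]
    have h2 : 1 ≤ ((c + 1 : ℕ) : ℝ) ^ 2 :=
      one_le_pow₀ (by push_cast; linarith [c.cast_nonneg (α := ℝ)])
    constructor <;> nlinarith
  obtain ⟨ha, h16⟩ := small a hdε
  obtain ⟨hb, -⟩ := small b hsε
  have hε2 : ε < 1 / 2 := by nlinarith
  have nh := (Net.le_norm_fwd hN₁ hε2 le_rfl hh).2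
  have nx := (Net.le_norm_fwd hN₁ hε2 le_rfl hx).2
  have nm := (Net.le_norm_fwd hN₂ hε2 le_rfl hm).2
  have ny := (Net.le_norm_fwd hN₂ hε2 le_rfl hy).2
  have hJ := hjoint.norm_act_sub_le nh nx nm ny (N₁.fwd a x)
  have hT1 := Net.norm_transpose_act_Q_sub_tTilde_le hN₁ hε ha h16 le_rfl hh hx
  have hT2 := Net.norm_transpose_act_Q_sub_tTilde_le hN₂ hε hb h16 le_rfl hm hy
  have ht1 := norm_two_pow_smul_tTilde_le hh x (a + 1)
  have ht2 := norm_two_pow_smul_tTilde_le hm y (b + 1)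
  have hE := Net.two_pow_mul_norm_le hN₁ hε hε2 le_rfl hh hx (by positivity) hJ
  rw [act_sub, act_smul] at hE
  set V := act (N₁.hiddenLam a h)ᵀ (act _ (N₁.fwd a x))
  -- Moving the hidden layers of the second network across the inner product exposes the vector that
  -- approximates `tTilde` there.
  have hI : inner ℝ (N₂.fwd b m) (act (Q (N₂.fwd b m) (N₂.fwd b y)) (N₂.fwd b y)) =
      inner ℝ m (act (N₂.hiddenLam b m)ᵀ
        (act (Q (N₂.fwd b m) (N₂.fwd b y)) (N₂.fwd b y))) := by
    rw [inner_act_transpose]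
    rfl
  rw [hI] at hE
  set T₁ := act (N₁.hiddenLam a h)ᵀ (act (Q (N₁.fwd a h) (N₁.fwd a x)) (N₁.fwd a x))
  set T₂ := act (N₂.hiddenLam b m)ᵀ (act (Q (N₂.fwd b m) (N₂.fwd b y)) (N₂.fwd b y))
  set t₁ := tTilde (a + 1) h x
  set t₂ := tTilde (b + 1) m y
  have hpow : ∀ c : ℕ, 16 * (c : ℝ) * √ε ≤ 1 → (1 + 2 * ε) ^ c ≤ 2 := by
    intro c hc
    have hcε : 16 * (c * ε) ≤ √ε := by nlinarith
    have := Net.one_add_pow_le (t := 2 * ε) (k := c) (by positivity) (by nlinarith)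
    nlinarith
  have hmy : 2 ^ b * (‖N₂.fwd b m‖ * ‖N₂.fwd b y‖) ≤ 2 * (‖m‖ * ‖y‖) := by
    have h1 := Net.norm_fwd_le hN₂ hε hε2 le_rfl hm
    have h2 := Net.norm_fwd_le hN₂ hε hε2 le_rfl hy
    calc _ ≤ 2 ^ b * ((√(1 / 2 + ε) ^ b * ‖m‖) * (√(1 / 2 + ε) ^ b * ‖y‖)) := by gcongr
      _ = 2 ^ b * (√(1 / 2 + ε) ^ b * √(1 / 2 + ε) ^ b) * (‖m‖ * ‖y‖) := by ring
      _ ≤ _ := by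
        rw [Net.two_pow_mul_sqrt_pow hε]
        gcongr
        exact hpow b hb
  -- Constants: 4 from the two last layers and 2 from each network's norm growth give 16ε, at most
  -- √ε.
  have hE' : 2 ^ (a + 1 + (b + 1)) * ‖V - (α / ℓ * inner ℝ m T₂) • T₁‖ ≤
      √ε / ℓ * (‖x‖ * ‖m‖ * ‖y‖) := by
    calc _ = 4 * 2 ^ b * (2 ^ a * ‖V - (α / ℓ * inner ℝ m T₂) • T₁‖) := by ring
      _ ≤ 4 * 2 ^ b * (2 * (ε / ℓ * ‖N₂.fwd b m‖ * ‖N₂.fwd b y‖) * ‖x‖) := by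
        refine mul_le_mul_of_nonneg_left (hE.trans ?_) (by positivity)
        gcongr
        exact hpow a ha
      _ = 8 * (ε / ℓ) * ‖x‖ * (2 ^ b * (‖N₂.fwd b m‖ * ‖N₂.fwd b y‖)) := by ring
      _ ≤ 8 * (ε / ℓ) * ‖x‖ * (2 * (‖m‖ * ‖y‖)) := by gcongr
      _ = 16 * ε / ℓ * (‖x‖ * ‖m‖ * ‖y‖) := by ring
      _ ≤ _ := by
        gcongr
        nlinarith
  -- With p = 2s²√ε and q = 2d²√ε ≤ 1, the factor p(1 + q) + q is at most (4s² + 2d²)√ε.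
  have hF := norm_inner_smul_sub_inner_smul_le (m := m) (by positivity) (norm_nonneg y)
    hT2 ht2 hT1 ht1
  have hF' : ‖(α / ℓ) • ((inner ℝ m ((2 ^ (b + 1) : ℝ) • T₂) : ℝ) • (2 ^ (a + 1) : ℝ) • T₁ -
      (inner ℝ m ((2 ^ (b + 1) : ℝ) • t₂) : ℝ) • (2 ^ (a + 1) : ℝ) • t₁)‖ ≤
      1 / ℓ * ((4 * ((b + 1 : ℕ) : ℝ) ^ 2 + 2 * ((a + 1 : ℕ) : ℝ) ^ 2) * √ε *
        (‖x‖ * ‖m‖ * ‖y‖)) := by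
    rw [norm_smul, norm_of_nonneg (by positivity)]
    gcongr
    refine hF.trans ?_
    gcongr
    have : 0 ≤ 2 * ((b + 1 : ℕ) : ℝ) ^ 2 * √ε := by positivity
    nlinarith
  have e : (2 ^ (a + 1 + (b + 1)) : ℝ) • (V - (α / ℓ * inner ℝ m t₂) • t₁) =
      (2 ^ (a + 1 + (b + 1)) : ℝ) • (V - (α / ℓ * inner ℝ m T₂) • T₁) +
      (α / ℓ) • ((inner ℝ m ((2 ^ (b + 1) : ℝ) • T₂) : ℝ) • (2 ^ (a + 1) : ℝ) • T₁ -
        (inner ℝ m ((2 ^ (b + 1) : ℝ) • t₂) : ℝ) • (2 ^ (a + 1) : ℝ) • t₁) := by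
    rw [inner_smul_right, inner_smul_right]
    module
  have hG : 2 ^ (a + 1 + (b + 1)) * ‖V - (α / ℓ * inner ℝ m t₂) • t₁‖ ≤
      208 * ((a + 1 : ℕ) : ℝ) ^ 3 * ((b + 1 : ℕ) : ℝ) ^ 3 * √ε / ℓ * (‖x‖ * ‖m‖ * ‖y‖) := by
    have h1 : (2 : ℝ) ^ (a + 1 + (b + 1)) * ‖V - (α / ℓ * inner ℝ m t₂) • t₁‖ =
        ‖(2 ^ (a + 1 + (b + 1)) : ℝ) • (V - (α / ℓ * inner ℝ m t₂) • t₁)‖ := by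
      rw [norm_smul, norm_of_nonneg (by positivity : (0 : ℝ) ≤ 2 ^ (a + 1 + (b + 1)))]
    rw [h1, e]
    refine (norm_add_le _ _).trans ?_
    rw [norm_smul, norm_of_nonneg (by positivity : (0 : ℝ) ≤ 2 ^ (a + 1 + (b + 1)))]
    refine (add_le_add hE' hF').trans ?_
    calc _ = (4 * ((b + 1 : ℕ) : ℝ) ^ 2 + 2 * ((a + 1 : ℕ) : ℝ) ^ 2 + 1) * √ε / ℓ *
          (‖x‖ * ‖m‖ * ‖y‖) := by ring
      _ ≤ _ := by gcongr
  -- Only the power of 2 is divided out: ℓ may be 0, so its inverse stays a factor throughout.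
  rw [← le_div_iff₀' (by positivity)] at hG
  refine hG.trans (le_of_eq ?_)
  rw [mul_comm ((2 : ℝ) ^ _) (ℓ : ℝ), ← div_div]
  ring

end CrossTerm

/-! ### The gradients -/

section Gradient

open Real Filter

theorem hadamard_apply {a : ℕ} (u v : EuclideanSpace ℝ (Fin a)) (i : Fin a) :
    hadamard u v i = u i * v i := rfl

theorem hadamard_comm {a : ℕ} (u v : EuclideanSpace ℝ (Fin a)) : hadamard u v = hadamard v u := by
  ext i
  simp [hadamard_apply, mul_comm]

theorem act_diagonal_eq {a : ℕ} (u x : EuclideanSpace ℝ (Fin a)) :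
    act (Matrix.diagonal u.ofLp) x = hadamard u x := by
  ext i
  rw [act_diagonal, hadamard_apply]

theorem relu_act {a b : ℕ} (W : Matrix (Fin a) (Fin b) ℝ) (x : EuclideanSpace ℝ (Fin b)) :
    Net.relu (act W x) = act (plusPart W x) x := by
  ext i
  rw [plusPart, mul_act, act_diagonal]
  change max (act W x i) 0 = _
  split_ifs with h
  · rw [one_mul, max_eq_left h.le]
  · rw [zero_mul, max_eq_right (not_lt.mp h)]

namespace Net

variable {d ℓ : ℕ} (N : Net d ℓ)

theorem hiddenOut_eq_fwd (k : ℕ) (x : N.Latent) : N.hiddenOut k x = N.fwd k x := by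
  induction k with
  | zero => rw [fwd_zero, hiddenOut]
  | succ k ih => rw [fwd_succ, hiddenOut, ih, relu_act]

theorem gen_eq (x : N.Latent) : N.gen x = act (N.lam x) x := by
  rw [gen, hiddenOut_eq_fwd, relu_act, act_lam]

/-- A nonzero p keeps its sign nearby; if p = 0 the sign of q decides, which is why δ approaches 0
from one side. -/
theorem eventually_sign_const (p q : ℝ) :
    ∃ P : Prop, ∀ᶠ δ : ℝ in 𝓝[>] 0, (0 < p + δ * q ↔ P) := by
  have hc : Tendsto (fun δ : ℝ => p + δ * q) (𝓝[>] 0) (𝓝 p) := by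
    have : Continuous fun δ : ℝ => p + δ * q := by fun_prop
    simpa using (this.tendsto 0).mono_left nhdsWithin_le_nhds
  rcases lt_trichotomy p 0 with hp | rfl | hp
  · refine ⟨False, ?_⟩
    filter_upwards [hc.eventually (gt_mem_nhds hp)] with δ hδ
    simpa using hδ.le
  · refine ⟨0 < q, ?_⟩
    filter_upwards [self_mem_nhdsWithin] with δ hδ
    rw [zero_add, mul_pos_iff_of_pos_left hδ]
  · refine ⟨True, ?_⟩
    filter_upwards [hc.eventually (lt_mem_nhds hp)] with δ hδ
    simpa using hδ

theorem eventually_plusPart_const {a b : ℕ} (W : Matrix (Fin a) (Fin b) ℝ)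
    (p q : EuclideanSpace ℝ (Fin b)) :
    ∃ P : Matrix (Fin a) (Fin b) ℝ, ∀ᶠ δ : ℝ in 𝓝[>] 0, plusPart W (p + δ • q) = P := by
  classical
  choose P hP using fun i => eventually_sign_const (act W p i) (act W q i)
  refine ⟨Matrix.diagonal (fun i => if P i then (1 : ℝ) else 0) * W, ?_⟩
  filter_upwards [eventually_all.mpr hP] with δ hδ
  rw [plusPart]
  congr 2
  funext i
  refine if_congr ?_ rfl rfl
  rw [← hδ i, act_add, act_smul]
  rfl

/-- Once the first k patterns are frozen, the next preactivations are affine in δ, so their signs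
freeze too. -/
theorem eventually_hiddenLam_const (k : ℕ) (x z : N.Latent) :
    ∃ L, ∀ᶠ δ : ℝ in 𝓝[>] 0, N.hiddenLam k (x + δ • z) = L := by
  induction k with
  | zero => exact ⟨1, Eventually.of_forall fun _ => rfl⟩
  | succ k ih =>
    obtain ⟨L, hL⟩ := ih
    obtain ⟨P, hP⟩ := eventually_plusPart_const (N.hidden k) (act L x) (act L z)
    refine ⟨P * L, ?_⟩
    filter_upwards [hL, hP] with δ h1 h2
    rw [hiddenLam, h1, act_add, act_smul, h2]

/-- Along a ray, the activation pattern is eventually constant. -/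
theorem eventually_lam_const (x z : N.Latent) :
    ∃ L, ∀ᶠ δ : ℝ in 𝓝[>] 0, N.lam (x + δ • z) = L := by
  obtain ⟨L, hL⟩ := N.eventually_hiddenLam_const (d - 1) x z
  obtain ⟨P, hP⟩ := eventually_plusPart_const N.outer (act L x) (act L z)
  refine ⟨P * L, ?_⟩
  filter_upwards [hL, hP] with δ h1 h2
  rw [lam, h1, act_add, act_smul, h2]

end Net

variable {d s ℓ : ℕ} {N₁ : Net d ℓ} {N₂ : Net s ℓ} {ε α : ℝ}

theorem objective_comm (h₀ h : N₁.Latent) (m₀ m : N₂.Latent) :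
    objective N₂ N₁ m₀ h₀ m h = objective N₁ N₂ h₀ m₀ h m := by
  rw [objective, objective, hadamard_comm (N₂.gen m₀), hadamard_comm (N₂.gen m)]

theorem gradExpr_eq_sub (h₀ h : N₁.Latent) (m₀ m : N₂.Latent) :
    gradExpr N₁ N₂ h₀ m₀ h m = crossTerm N₁ N₂ h h m m - crossTerm N₁ N₂ h h₀ m m₀ := by
  rw [gradExpr, act_sub, crossTerm, crossTerm, mul_act, mul_act, mul_act, mul_act, pow_two,
    Matrix.diagonal_mul_diagonal]
  rfl

/-- The derivative of the objective along a ray. -/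
theorem hasDerivAt_half_norm_sq_ray {a k : ℕ} (L : Matrix (Fin a) (Fin k) ℝ)
    (b c : EuclideanSpace ℝ (Fin a)) (h z : EuclideanSpace ℝ (Fin k)) :
    HasDerivAt (fun δ : ℝ => 1 / 2 * ‖c - hadamard b (act L (h + δ • z))‖ ^ 2)
      (inner ℝ (act Lᵀ (hadamard b (hadamard b (act L h)) - hadamard b c)) z) 0 := by
  have e : ∀ δ : ℝ, c - hadamard b (act L (h + δ • z)) =
      (c - hadamard b (act L h)) - δ • hadamard b (act L z) := by
    intro δ
    ext i
    simp only [act_add, act_smul, PiLp.sub_apply, PiLp.smul_apply, PiLp.add_apply, hadamard_apply,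
      smul_eq_mul]
    ring
  simp only [e]
  have h1 : HasDerivAt (fun δ : ℝ => (c - hadamard b (act L h)) - δ • hadamard b (act L z))
      (-hadamard b (act L z)) 0 := by
    simpa using ((hasDerivAt_id (0 : ℝ)).smul_const (hadamard b (act L z))).const_sub
      (c - hadamard b (act L h))
  have h2 := h1.norm_sq.const_mul (1 / 2)
  refine h2.congr_deriv ?_
  rw [zero_smul, sub_zero, real_inner_comm z (act Lᵀ _), inner_act_transpose, ← mul_assoc,
    one_div_mul_cancel two_ne_zero, one_mul]
  simp only [PiLp.inner_apply, PiLp.sub_apply, PiLp.neg_apply, hadamard_apply, RCLike.inner_apply,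
    conj_trivial]
  refine Finset.sum_congr rfl fun i _ => ?_
  ring

theorem gradExpr_eq_act {h₀ h : N₁.Latent} {m₀ m : N₂.Latent} :
    gradExpr N₁ N₂ h₀ m₀ h m = act (N₁.lam h)ᵀ
      (hadamard (N₂.gen m) (hadamard (N₂.gen m) (act (N₁.lam h) h)) -
        hadamard (N₂.gen m) (hadamard (N₁.gen h₀) (N₂.gen m₀))) := by
  rw [gradExpr, pow_two, mul_act]
  simp only [act_diagonal_eq, ← Net.gen_eq]
  congr 2
  ext i
  simp only [hadamard_apply]
  ring

/-- Directional derivatives of the objective are inner products with one-sided limits of the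
explicit gradient expression. -/
theorem exists_tendsto_gradExpr (h₀ h : N₁.Latent) (m₀ m : N₂.Latent) (z : N₁.Latent)
    (hF : DifferentiableAt ℝ (fun h' => objective N₁ N₂ h₀ m₀ h' m) h) :
    ∃ v : N₁.Latent,
      Tendsto (fun δ : ℝ => gradExpr N₁ N₂ h₀ m₀ (h + δ • z) m) (𝓝[>] 0) (𝓝 v) ∧
      inner ℝ (gradient (fun h' => objective N₁ N₂ h₀ m₀ h' m) h) z = (inner ℝ v z : ℝ) := by
  obtain ⟨L, hL⟩ := N₁.eventually_lam_const h z
  set b := N₂.gen m with hb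
  set c := hadamard (N₁.gen h₀) (N₂.gen m₀) with hc
  refine ⟨act Lᵀ (hadamard b (hadamard b (act L h)) - hadamard b c), ?_, ?_⟩
  · have hcont : Continuous fun δ : ℝ =>
        act Lᵀ (hadamard b (hadamard b (act L (h + δ • z))) - hadamard b c) := by
      have h1 : Continuous fun δ : ℝ => act L (h + δ • z) :=
        (continuous_act L).comp (by fun_prop)
      refine (continuous_act _).comp (Continuous.sub ?_ continuous_const)
      simp only [← act_diagonal_eq]
      exact (continuous_act _).comp ((continuous_act _).comp h1)
    have h2 := (hcont.tendsto 0).mono_left (nhdsWithin_le_nhds (s := Set.Ioi 0))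
    rw [zero_smul, add_zero] at h2
    refine h2.congr' ?_
    filter_upwards [hL] with δ hδ
    rw [gradExpr_eq_act, hδ]
  · set F := fun h' => objective N₁ N₂ h₀ m₀ h' m
    have hray : HasDerivAt (fun δ : ℝ => h + δ • z) z 0 := by
      simpa using ((hasDerivAt_id (0 : ℝ)).smul_const z).const_add h
    have hd1 : HasDerivAt (fun δ : ℝ => F (h + δ • z)) (inner ℝ (gradient F h) z) 0 := by
      have hg : HasFDerivAt F (InnerProductSpace.toDual ℝ _ (gradient F h)) (h + (0 : ℝ) • z) := by
        simpa using hF.hasGradientAt.hasFDerivAt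
      exact hg.comp_hasDerivAt (0 : ℝ) hray
    have hd2 := hasDerivAt_half_norm_sq_ray L b c h z
    have heq : (fun δ : ℝ => F (h + δ • z)) =ᶠ[𝓝[>] 0]
        fun δ : ℝ => 1 / 2 * ‖c - hadamard b (act L (h + δ • z))‖ ^ 2 := by
      filter_upwards [hL] with δ hδ
      simp only [F, objective, ← hb, ← hc]
      rw [N₁.gen_eq, hδ, hadamard_comm b]
    -- The frozen formula agrees with F only for δ > 0; continuity gives equality at 0, as needed to
    -- identify the one-sided derivatives.
    have h0 := tendsto_nhds_unique
      ((hd1.continuousAt.tendsto.mono_left (nhdsWithin_le_nhds (s := Set.Ioi 0))).congr' heq)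
      (hd2.continuousAt.tendsto.mono_left nhdsWithin_le_nhds)
    have hd3 := hd2.hasDerivWithinAt (s := Set.Ioi 0)
    exact (uniqueDiffWithinAt_Ioi (0 : ℝ)).eq_deriv _ (hd1.hasDerivWithinAt (s := Set.Ioi 0))
      (hd3.congr_of_eventuallyEq heq h0)

end Gradient

/-! ### Error bounds for gradients and their one-sided limits -/

section GradientBounds

open Real Filter

variable {d s ℓ : ℕ} {N₁ : Net d ℓ} {N₂ : Net s ℓ} {α C : ℝ}

/-- The vector w may vary with z, as one-sided limits do with the direction. Taking z = v - t and
applying Cauchy–Schwarz suffices. -/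
theorem norm_sub_le_of_forall_inner_eq {E : Type*} [NormedAddCommGroup E] [InnerProductSpace ℝ E]
    {v t : E} {R : ℝ} (hv : ∀ z, ∃ w, ‖w - t‖ ≤ R ∧ (inner ℝ v z : ℝ) = inner ℝ w z) :
    ‖v - t‖ ≤ R := by
  obtain ⟨w, hw, e⟩ := hv (v - t)
  have hR : 0 ≤ R := (norm_nonneg _).trans hw
  rcases (norm_nonneg (v - t)).eq_or_lt with h0 | h0
  · rwa [← h0]
  · have h1 : ‖v - t‖ ^ 2 ≤ ‖w - t‖ * ‖v - t‖ := by
      rw [← real_inner_self_eq_norm_sq, inner_sub_left, e, ← inner_sub_left]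
      exact real_inner_le_norm _ _
    nlinarith

/-- Since `tTilde a u u` is 2⁻ᵃ u, the first term of t is the limiting cross term at the point
itself, matching `gradExpr_eq_sub`. -/
theorem tVec_eq_sub (a b : ℕ) {j k : ℕ} (u₀ : EuclideanSpace ℝ (Fin j))
    (v₀ : EuclideanSpace ℝ (Fin k)) {u : EuclideanSpace ℝ (Fin j)} {v : EuclideanSpace ℝ (Fin k)}
    (hu : u ≠ 0) (hv : v ≠ 0) :
    tVec a b ℓ α u₀ v₀ u v = (α / ℓ * inner ℝ v (tTilde b v v)) • tTilde a u u -
      (α / ℓ * inner ℝ v (tTilde b v v₀)) • tTilde a u u₀ := by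
  rw [tVec, tTilde_self hu, tTilde_self hv, inner_smul_right, real_inner_self_eq_norm_sq,
    smul_smul]
  congr 2
  rw [pow_add, mul_comm _ (ℓ : ℝ), ← div_div, ← div_div]
  ring

variable (hC : 0 ≤ C)
  (hcross : ∀ (h x : N₁.Latent) (m y : N₂.Latent), h ≠ 0 → x ≠ 0 → m ≠ 0 → y ≠ 0 →
    ‖crossTerm N₁ N₂ h x m y - (α / ℓ * inner ℝ m (tTilde s m y)) • tTilde d h x‖ ≤
      C * ‖x‖ * ‖m‖ * ‖y‖)
  {h₀ : N₁.Latent} {m₀ : N₂.Latent} (hh₀ : h₀ ≠ 0) (hm₀ : m₀ ≠ 0)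
include hC hcross hh₀ hm₀

theorem norm_gradExpr_sub_tVec_le {h : N₁.Latent} {m : N₂.Latent} (hh : h ≠ 0) (hm : m ≠ 0) :
    ‖gradExpr N₁ N₂ h₀ m₀ h m - tVec d s ℓ α h₀ m₀ h m‖ ≤
      2 * C * max (‖h‖ * ‖m‖) (‖h₀‖ * ‖m₀‖) * ‖m‖ := by
  have h1 := hcross h h m m hh hh hm hm
  have h2 := hcross h h₀ m m₀ hh hh₀ hm hm₀
  rw [gradExpr_eq_sub, tVec_eq_sub d s h₀ m₀ hh hm, sub_sub_sub_comm]
  refine (norm_sub_le _ _).trans ((add_le_add h1 h2).trans ?_)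
  calc _ = C * (‖h‖ * ‖m‖) * ‖m‖ + C * (‖h₀‖ * ‖m₀‖) * ‖m‖ := by ring
    _ ≤ C * max (‖h‖ * ‖m‖) (‖h₀‖ * ‖m₀‖) * ‖m‖ +
        C * max (‖h‖ * ‖m‖) (‖h₀‖ * ‖m₀‖) * ‖m‖ := by
        gcongr
        · exact le_max_left _ _
        · exact le_max_right _ _
    _ = _ := by ring

omit hC hcross hh₀ hm₀ in
theorem tendsto_ray {k : ℕ} (h w : EuclideanSpace ℝ (Fin k)) :
    Tendsto (fun δ : ℝ => h + δ • w) (𝓝[>] 0) (𝓝 h) := by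
  have : Continuous fun δ : ℝ => h + δ • w := by fun_prop
  simpa using (this.tendsto 0).mono_left (nhdsWithin_le_nhds (s := Set.Ioi 0))

omit hC hcross in
/-- A bound near `(h, m)` along a ray passes to one-sided limits. -/
theorem norm_sub_tVec_le_of_tendsto {h : N₁.Latent} {m : N₂.Latent} (hh : h ≠ 0) (hm : m ≠ 0)
    (w₁ : N₁.Latent) (w₂ : N₂.Latent) {G : ℝ → N₁.Latent} {v : N₁.Latent}
    (hG : ∀ᶠ δ : ℝ in 𝓝[>] 0,
      ‖G δ - tVec d s ℓ α h₀ m₀ (h + δ • w₁) (m + δ • w₂)‖ ≤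
        2 * C * max (‖h + δ • w₁‖ * ‖m + δ • w₂‖) (‖h₀‖ * ‖m₀‖) * ‖m + δ • w₂‖)
    (hv : Tendsto G (𝓝[>] 0) (𝓝 v)) :
    ‖v - tVec d s ℓ α h₀ m₀ h m‖ ≤ 2 * C * max (‖h‖ * ‖m‖) (‖h₀‖ * ‖m₀‖) * ‖m‖ := by
  have r1 := tendsto_ray h w₁
  have r2 := tendsto_ray m w₂
  have r3 := (continuousAt_tVec d s ℓ α hh₀ hm₀ hh hm).tendsto.comp (r1.prodMk_nhds r2)
  exact le_of_tendsto_of_tendsto (hv.sub r3).norm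
    ((((r1.norm.mul r2.norm).max tendsto_const_nhds).const_mul (2 * C)).mul r2.norm) hG

/-- Equality of the gradient with `gradExpr` at the point is not needed: the bound on `gradExpr`
holds at all nearby points of a ray and passes to its limit. -/
theorem norm_gradient_sub_tVec_le {h : N₁.Latent} {m : N₂.Latent} (hh : h ≠ 0) (hm : m ≠ 0)
    (hF : DifferentiableAt ℝ (fun h' => objective N₁ N₂ h₀ m₀ h' m) h) :
    ‖gradient (fun h' => objective N₁ N₂ h₀ m₀ h' m) h - tVec d s ℓ α h₀ m₀ h m‖ ≤
      2 * C * max (‖h‖ * ‖m‖) (‖h₀‖ * ‖m₀‖) * ‖m‖ := by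
  refine norm_sub_le_of_forall_inner_eq fun z => ?_
  obtain ⟨v, hv, e⟩ := exists_tendsto_gradExpr h₀ h m₀ m z hF
  refine ⟨v, norm_sub_tVec_le_of_tendsto hh₀ hm₀ hh hm z 0 ?_ hv, e⟩
  filter_upwards [(tendsto_ray h z).eventually_ne hh] with δ hδ
  rw [smul_zero, add_zero]
  exact norm_gradExpr_sub_tVec_le hC hcross hh₀ hm₀ hδ hm

theorem norm_lim_gradient_sub_tVec_le {h : N₁.Latent} {m : N₂.Latent} (hh : h ≠ 0) (hm : m ≠ 0)
    (w₁ : N₁.Latent) (w₂ : N₂.Latent) (v : N₁.Latent)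
    (hF : ∀ᶠ δ : ℝ in 𝓝[>] 0, DifferentiableAt ℝ
      (fun h' => objective N₁ N₂ h₀ m₀ h' (m + δ • w₂)) (h + δ • w₁))
    (hv : Tendsto (fun δ : ℝ => gradient
      (fun h' => objective N₁ N₂ h₀ m₀ h' (m + δ • w₂)) (h + δ • w₁)) (𝓝[>] 0) (𝓝 v)) :
    ‖v - tVec d s ℓ α h₀ m₀ h m‖ ≤ 2 * C * max (‖h‖ * ‖m‖) (‖h₀‖ * ‖m₀‖) * ‖m‖ := by
  refine norm_sub_tVec_le_of_tendsto hh₀ hm₀ hh hm w₁ w₂ ?_ hv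
  filter_upwards [hF, (tendsto_ray h w₁).eventually_ne hh, (tendsto_ray m w₂).eventually_ne hm]
    with δ h1 h2 h3
  exact norm_gradient_sub_tVec_le hC hcross hh₀ hm₀ h2 h3 h1

end GradientBounds

/-- For c ≥ 1, 16c² is dominated by 16π(c⁴ + e⁴), the reciprocal of the bound on √ε. -/
theorem sixteen_mul_sq_mul_sqrt_le_one {c e ε : ℝ} (hc : 1 ≤ c)
    (hε : ε < 1 / ((c ^ 4 + e ^ 4) * 16 * Real.pi) ^ 2) : 16 * c ^ 2 * √ε ≤ 1 := by
  have hπ := Real.pi_gt_three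
  have h2 : 1 ≤ c ^ 2 := one_le_pow₀ hc
  have hD : 16 * c ^ 2 ≤ (c ^ 4 + e ^ 4) * 16 * Real.pi := by
    have h3 : c ^ 2 ≤ c ^ 4 + e ^ 4 := by nlinarith [sq_nonneg (e ^ 2)]
    nlinarith
  have hD0 : 0 < (c ^ 4 + e ^ 4) * 16 * Real.pi := by linarith
  have h4 : √ε ≤ 1 / ((c ^ 4 + e ^ 4) * 16 * Real.pi) := by
    rw [← one_div_pow] at hε
    exact Real.sqrt_le_iff.mpr ⟨by positivity, hε.le⟩
  calc 16 * c ^ 2 * √ε ≤ ((c ^ 4 + e ^ 4) * 16 * Real.pi) *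
        (1 / ((c ^ 4 + e ^ 4) * 16 * Real.pi)) := by gcongr
    _ = 1 := mul_one_div_cancel hD0.ne'

end BlindDemod

open BlindDemod Filter in
theorem mainTheorem3 (d s ℓ : ℕ) (hd : 2 ≤ d) (hs : 2 ≤ s)
    (N₁ : Net d ℓ) (N₂ : Net s ℓ) (ε α₁ α₂ α : ℝ)
    (hε : 0 < ε) (hε' : ε < 1 / (((d : ℝ) ^ 4 + (s : ℝ) ^ 4) * 16 * Real.pi) ^ 2)
    (hα₁ : 0 < α₁) (hα₁' : α₁ ≤ 1) (hα₂ : 0 < α₂) (hα₂' : α₂ ≤ 1) (hα : α = α₁ * α₂)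
    (hN₁ : N₁.LayersWDC ε α₁) (hN₂ : N₂.LayersWDC ε α₂)
    (hjoint : JointWDC N₁.outer N₂.outer ε α) :
    -- concentration of the cross terms
    (∀ (h x : N₁.Latent) (m y : N₂.Latent), h ≠ 0 → x ≠ 0 → m ≠ 0 → y ≠ 0 →
      ‖crossTerm N₁ N₂ h x m y - (α / ℓ * inner ℝ m (tTilde s m y)) • tTilde d h x‖
          ≤ 208 * d ^ 3 * s ^ 3 * √ε / (2 ^ (d + s) * ℓ) * ‖x‖ * ‖m‖ * ‖y‖ ∧
      ‖crossTerm N₂ N₁ m y h x - (α / ℓ * inner ℝ h (tTilde d h x)) • tTilde s m y‖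
          ≤ 208 * d ^ 3 * s ^ 3 * √ε / (2 ^ (d + s) * ℓ) * ‖y‖ * ‖h‖ * ‖x‖) ∧
    -- concentration of the partial gradients
    (∀ (h₀ : N₁.Latent) (m₀ : N₂.Latent), h₀ ≠ 0 → m₀ ≠ 0 →
      -- the vectors around which they concentrate are continuous
      ContinuousOn (fun z : N₁.Latent × N₂.Latent => tVec d s ℓ α h₀ m₀ z.1 z.2)
        {z | z.1 ≠ 0 ∧ z.2 ≠ 0} ∧
      ContinuousOn (fun z : N₁.Latent × N₂.Latent => tVec s d ℓ α m₀ h₀ z.2 z.1)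
        {z | z.1 ≠ 0 ∧ z.2 ≠ 0} ∧
      ∀ (h : N₁.Latent) (m : N₂.Latent), h ≠ 0 → m ≠ 0 →
        -- the explicit gradient expressions, at every point
        ‖gradExpr N₁ N₂ h₀ m₀ h m - tVec d s ℓ α h₀ m₀ h m‖
          ≤ 416 * d ^ 3 * s ^ 3 * √ε / (2 ^ (d + s) * ℓ) *
            max (‖h‖ * ‖m‖) (‖h₀‖ * ‖m₀‖) * ‖m‖ ∧
        ‖gradExpr N₂ N₁ m₀ h₀ m h - tVec s d ℓ α m₀ h₀ m h‖
          ≤ 416 * d ^ 3 * s ^ 3 * √ε / (2 ^ (d + s) * ℓ) *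
            max (‖h‖ * ‖m‖) (‖h₀‖ * ‖m₀‖) * ‖h‖ ∧
        -- the partial gradients, wherever they exist
        (DifferentiableAt ℝ (fun h' => objective N₁ N₂ h₀ m₀ h' m) h →
          ‖gradient (fun h' => objective N₁ N₂ h₀ m₀ h' m) h - tVec d s ℓ α h₀ m₀ h m‖
            ≤ 416 * d ^ 3 * s ^ 3 * √ε / (2 ^ (d + s) * ℓ) *
              max (‖h‖ * ‖m‖) (‖h₀‖ * ‖m₀‖) * ‖m‖) ∧
        (DifferentiableAt ℝ (fun m' => objective N₁ N₂ h₀ m₀ h m') m →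
          ‖gradient (fun m' => objective N₁ N₂ h₀ m₀ h m') m - tVec s d ℓ α m₀ h₀ m h‖
            ≤ 416 * d ^ 3 * s ^ 3 * √ε / (2 ^ (d + s) * ℓ) *
              max (‖h‖ * ‖m‖) (‖h₀‖ * ‖m₀‖) * ‖h‖) ∧
        -- their one-sided limits
        (∀ (w₁ : N₁.Latent) (w₂ : N₂.Latent) (v : N₁.Latent),
          (∀ᶠ δ : ℝ in 𝓝[>] 0, DifferentiableAt ℝ
            (fun h' => objective N₁ N₂ h₀ m₀ h' (m + δ • w₂)) (h + δ • w₁)) →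
          Tendsto (fun δ : ℝ => gradient
            (fun h' => objective N₁ N₂ h₀ m₀ h' (m + δ • w₂)) (h + δ • w₁)) (𝓝[>] 0) (𝓝 v) →
          ‖v - tVec d s ℓ α h₀ m₀ h m‖
            ≤ 416 * d ^ 3 * s ^ 3 * √ε / (2 ^ (d + s) * ℓ) *
              max (‖h‖ * ‖m‖) (‖h₀‖ * ‖m₀‖) * ‖m‖) ∧
        (∀ (w₁ : N₁.Latent) (w₂ : N₂.Latent) (v : N₂.Latent),
          (∀ᶠ δ : ℝ in 𝓝[>] 0, DifferentiableAt ℝ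
            (fun m' => objective N₁ N₂ h₀ m₀ (h + δ • w₁) m') (m + δ • w₂)) →
          Tendsto (fun δ : ℝ => gradient
            (fun m' => objective N₁ N₂ h₀ m₀ (h + δ • w₁) m') (m + δ • w₂)) (𝓝[>] 0) (𝓝 v) →
          ‖v - tVec s d ℓ α m₀ h₀ m h‖
            ≤ 416 * d ^ 3 * s ^ 3 * √ε / (2 ^ (d + s) * ℓ) *
              max (‖h‖ * ‖m‖) (‖h₀‖ * ‖m₀‖) * ‖h‖)) := by
  have h1d : (1 : ℝ) ≤ d := by exact_mod_cast (by omega : 1 ≤ d)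
  have h1s : (1 : ℝ) ≤ s := by exact_mod_cast (by omega : 1 ≤ s)
  have hdε := sixteen_mul_sq_mul_sqrt_le_one h1d hε'
  have hsε := sixteen_mul_sq_mul_sqrt_le_one h1s
    (by rwa [add_comm] : ε < 1 / (((s : ℝ) ^ 4 + (d : ℝ) ^ 4) * 16 * Real.pi) ^ 2)
  have hα0 : 0 ≤ α := by rw [hα]; positivity
  have hα1 : α ≤ 1 := by rw [hα]; exact mul_le_one₀ hα₁' hα₂.le hα₂'
  have hcross₁ : ∀ (h x : N₁.Latent) (m y : N₂.Latent), h ≠ 0 → x ≠ 0 → m ≠ 0 → y ≠ 0 →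
      ‖crossTerm N₁ N₂ h x m y - (α / ℓ * inner ℝ m (tTilde s m y)) • tTilde d h x‖
        ≤ 208 * d ^ 3 * s ^ 3 * √ε / (2 ^ (d + s) * ℓ) * ‖x‖ * ‖m‖ * ‖y‖ :=
    fun h x m y hh hx hm hy => norm_crossTerm_sub_le hd hs hε hdε hsε hα0 hα1 hN₁.1 hN₂.1
      hjoint.1 hh hx hm hy
  have hcross₂ : ∀ (m y : N₂.Latent) (h x : N₁.Latent), m ≠ 0 → y ≠ 0 → h ≠ 0 → x ≠ 0 →
      ‖crossTerm N₂ N₁ m y h x - (α / ℓ * inner ℝ h (tTilde d h x)) • tTilde s m y‖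
        ≤ 208 * d ^ 3 * s ^ 3 * √ε / (2 ^ (d + s) * ℓ) * ‖y‖ * ‖h‖ * ‖x‖ := by
    intro m y h x hm hy hh hx
    refine (norm_crossTerm_sub_le hs hd hε hsε hdε hα0 hα1 hN₂.1 hN₁.1
      hjoint.2 hm hy hh hx).trans (le_of_eq ?_)
    rw [add_comm s d]
    ring
  have hC : 0 ≤ 208 * (d : ℝ) ^ 3 * s ^ 3 * √ε / (2 ^ (d + s) * ℓ) := by positivity
  have e2 : 416 * (d : ℝ) ^ 3 * s ^ 3 * √ε / (2 ^ (d + s) * ℓ) =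
      2 * (208 * (d : ℝ) ^ 3 * s ^ 3 * √ε / (2 ^ (d + s) * ℓ)) := by ring
  refine ⟨fun h x m y hh hx hm hy => ⟨hcross₁ h x m y hh hx hm hy, hcross₂ m y h x hm hy hh hx⟩,
    fun h₀ m₀ hh₀ hm₀ => ⟨?_, ?_, fun h m hh hm => ?_⟩⟩
  · exact fun z hz => (continuousAt_tVec d s ℓ α hh₀ hm₀ hz.1 hz.2).continuousWithinAt
  · exact fun z hz => ((continuousAt_tVec s d ℓ α hm₀ hh₀ hz.2 hz.1).comp
      (f := Prod.swap) (x := z) continuous_swap.continuousAt).continuousWithinAt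
  · have emax : max (‖h‖ * ‖m‖) (‖h₀‖ * ‖m₀‖) = max (‖m‖ * ‖h‖) (‖m₀‖ * ‖h₀‖) := by
      rw [mul_comm ‖h‖, mul_comm ‖h₀‖]
    rw [e2]
    refine ⟨norm_gradExpr_sub_tVec_le hC hcross₁ hh₀ hm₀ hh hm, ?_,
      norm_gradient_sub_tVec_le hC hcross₁ hh₀ hm₀ hh hm, ?_,
      norm_lim_gradient_sub_tVec_le hC hcross₁ hh₀ hm₀ hh hm, ?_⟩
    · rw [emax]
      exact norm_gradExpr_sub_tVec_le hC hcross₂ hm₀ hh₀ hm hh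
    · rw [emax]
      -- Symmetry of the objective turns the gradient in m into the gradient in the first variable
      -- with the networks exchanged.
      simp only [← objective_comm (N₁ := N₁) (N₂ := N₂)]
      exact norm_gradient_sub_tVec_le hC hcross₂ hm₀ hh₀ hm hh
    · rw [emax]
      simp only [← objective_comm (N₁ := N₁) (N₂ := N₂)]
      exact fun w₁ w₂ v => norm_lim_gradient_sub_tVec_le hC hcross₂ hm₀ hh₀ hm hh w₂ w₁ v
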